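/- Let $d\ge 1$. For $f_0\in H^2(\mathbb R^d)$ (complex-valued, in particular real-valued) and $c>0$, let $w_c:\mathbb R\times\mathbb R^d\to\mathbb C$ denote a jointly measurable version of the solution of the undamped wave equation $$\partial_{tt}w_c=c^2\Delta w_c,\qquad w_c(0,\cdot)=f_0,\qquad \partial_t w_c(0,\cdot)=0,$$ on $\mathbb R\times\mathbb R^d$, meaning that $t\mapsto w_c(t,\cdot)\in L_2(\mathbb R^d)$ is twice differentiable and the equation holds in $L_2(\mathbb R^d)$ for every $t\in\mathbb R$, with $\Delta$ the distributional Laplacian. For $a>0$ let $(N(t))_{t\ge0}$ be a homogeneous Poisson process with rate $a$ (almost surely nondecreasing right-continuous paths, $N(0)=0$ almost surely, independent increments, $N(t)-N(s)\sim\mathrm{Poi}(a(t-s))$ for $s\le t$), put $$\tau_t=\int_0^t(-1)^{N(s)}\,ds,\qquad u(t,x)=\mathbb E\big[w_c(\tau_t,x)\big],$$ and, for $\sigma>0$ with $\sigma^2=c^2/a$ and a one-dimensional standard Wiener process $W$, put $$h(t,x)=\mathbb E\big[w_1(\sigma W(t),x)\big].$$ For every $t\ge0$ these expectations exist for almost every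 $x$, and $u(t,\cdot),h(t,\cdot)\in L_2(\mathbb R^d)$. For every $c_0>0$ there is a constant $C=C(c_0,d)>0$ such that for all $f_0\in H^2(\mathbb R^d)$, all $a>0$ and all $c\ge c_0$, $$\|h(t,\cdot)-u(t,\cdot)\|_{L_2(\mathbb R^d)}\le C\Big(\frac1{at}+\frac1{c\,(ta)^{1/2}}\Big)\|f_0\|_{L_2(\mathbb R^d)}\qquad\text{for all }t>0.$$ In particular, for fixed $a$ and $c$, $\|h(t,\cdot)-u(t,\cdot)\|_{L_2}\to0$ as $t\to\infty$; and for every $f_0\in H^2(\mathbb R^d)$, $\sigma>0$ and $t\ge0$, $\|h(t,\cdot)-u(t,\cdot)\|_{L_2}\to0$ as $a,c\to\infty$ with $c^2/a=\sigma^2$ fixed. -/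

import Mathlib

open MeasureTheory ProbabilityTheory Filter Topology
open scoped NNReal ENNReal SchwartzMap Laplacian

/-- Membership in the Sobolev space `H²(ℝ^d)`: the function is square integrable and its class is
in Mathlib's Sobolev space of order `2` and integrability exponent `2`. -/
def IsSobolevH2 {d : ℕ} (f : EuclideanSpace ℝ (Fin d) → ℂ) : Prop :=
  ∃ hf : MemLp f 2 volume,
    TemperedDistribution.MemSobolev 2 2
      ((hf.toLp f : Lp ℂ 2 (volume : Measure (EuclideanSpace ℝ (Fin d)))) :
        𝓢'(EuclideanSpace ℝ (Fin d), ℂ))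

/-- `w` is the solution of the undamped wave equation `∂ₜₜ w = c² Δ w` with `w(0, ·) = f₀` and
`∂ₜ w(0, ·) = 0`: it is jointly measurable, `t ↦ w(t, ·)` is twice differentiable as a curve in
`L²(ℝ^d)`, and the equation holds in `L²(ℝ^d)`, with `Δ` the distributional Laplacian.
Time runs through all of `ℝ`, because the random times inserted below take both signs. -/
structure IsWaveSolution {d : ℕ} (c : ℝ) (f₀ : EuclideanSpace ℝ (Fin d) → ℂ)
    (w : ℝ → EuclideanSpace ℝ (Fin d) → ℂ) : Prop where
  measurable : Measurable (Function.uncurry w)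
  initial : w 0 =ᵐ[volume] f₀
  wave : ∃ W V A : ℝ → Lp ℂ 2 (volume : Measure (EuclideanSpace ℝ (Fin d))),
    (∀ t, W t =ᵐ[volume] w t) ∧
    (∀ t, HasDerivAt W (V t) t) ∧
    (∀ t, HasDerivAt V (A t) t) ∧
    V 0 = 0 ∧
    ∀ t, (A t : 𝓢'(EuclideanSpace ℝ (Fin d), ℂ)) =
      ((c : ℂ) ^ 2) • Δ (W t : 𝓢'(EuclideanSpace ℝ (Fin d), ℂ))

/-- `N` is a homogeneous Poisson process with rate `a`. The paths are almost surely nondecreasing,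
so that the (truncated) subtraction of natural numbers is the true increment almost surely. -/
structure IsPoissonProcess {Ω : Type*} [MeasurableSpace Ω] (a : ℝ) (N : ℝ≥0 → Ω → ℕ)
    (P : Measure Ω) : Prop where
  zero : ∀ᵐ ω ∂P, N 0 ω = 0
  indep : HasIndepIncrements N P
  law : ∀ s t : ℝ≥0, s ≤ t →
    HasLaw (fun ω => N t ω - N s ω) (poissonMeasure (Real.toNNReal (a * ((t : ℝ) - s)))) P
  mono : ∀ᵐ ω ∂P, Monotone fun t => N t ω
  rightCont : ∀ᵐ ω ∂P, ∀ t, ContinuousWithinAt (fun s => N s ω) (Set.Ici t) t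

/-- The random time `τ_t = ∫₀ᵗ (-1)^{N(s)} ds`. -/
noncomputable def randomTime {Ω : Type*} (N : ℝ≥0 → Ω → ℕ) (t : ℝ≥0) (ω : Ω) : ℝ :=
  ∫ s in (0 : ℝ)..t, (-1 : ℝ) ^ N s.toNNReal ω

/-- Kac's insertion `u(t, x) = 𝔼[w(τ_t, x)]`. -/
noncomputable def kacInsertion {d : ℕ} {Ω : Type*} [MeasurableSpace Ω] (P : Measure Ω)
    (N : ℝ≥0 → Ω → ℕ) (w : ℝ → EuclideanSpace ℝ (Fin d) → ℂ) (t : ℝ≥0)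
    (x : EuclideanSpace ℝ (Fin d)) : ℂ :=
  ∫ ω, w (randomTime N t ω) x ∂P

/-- The insertion of a scaled Wiener process, `h(t, x) = 𝔼[w(σ B(t), x)]`. -/
noncomputable def wienerInsertion {d : ℕ} {Ω : Type*} [MeasurableSpace Ω] (P : Measure Ω)
    (B : ℝ≥0 → Ω → ℝ) (σ : ℝ) (w : ℝ → EuclideanSpace ℝ (Fin d) → ℂ) (t : ℝ≥0)
    (x : EuclideanSpace ℝ (Fin d)) : ℂ :=
  ∫ ω, w (σ * B t ω) x ∂P

/-! On the Fourier side the wave at time `s` is `cos (l s)` times the transform of `f₀`, with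
frequency `l = 2π c ‖ξ‖` (`fourier_wave_ae_eq`). Averaging over a random time replaces the cosine by
its expectation (`wave_average`), so by Plancherel the `L²` distance of the two insertions is at
most the supremum over `ξ` of the difference of two scalar multipliers, times the norm of `f₀`.

For the Wiener process the multiplier is a Gaussian characteristic function; since `σ² = c² / a`, it
equals `exp (-(l² t / (2a)))`. For `τ_t` it is `p(t) = 𝔼[cos (l τ_t)]`, which solves the damped
equation `p'' + 2a p' + l² p = 0`, `p(0) = 1`, `p'(0) = 0` (`IsPoissonProcess.isTelegraphSystem`):
the sign `(-1)^N` loses memory at rate `2a`.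

It remains to compare `p` with the heat profile uniformly in `l`
(`IsTelegraphSystem.abs_sub_exp_le`). For `2|l| ≤ a` the slow characteristic root is close to
`-l²/(2a)`, and the error is absorbed by the exponential; for larger `|l|` both terms decay
exponentially at a rate proportional to `a`. Either way the difference is at most `47 / (a t)`, so
the first summand of the claimed bound suffices, with an absolute constant, and both limits follow.
-/

/-! ### Multiplication operators and linear second order equations in `L²` -/

section Multiplier

variable {α : Type*} [MeasurableSpace α] {μ : Measure α}

lemma Lp.norm_le_of_forall_ae_bound_top {f : Lp ℂ ∞ μ} {C : ℝ} (hC : 0 ≤ C)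
    (h : ∀ᵐ x ∂μ, ‖f x‖ ≤ C) : ‖f‖ ≤ C := by
  rw [Lp.norm_def, eLpNorm_exponent_top]
  exact ENNReal.toReal_le_of_le_ofReal hC (eLpNormEssSup_le_of_ae_bound h)

lemma memLp_top_exp_mul {κ : α → ℂ} (hκ : Measurable κ) {K : ℝ} (hK : ∀ x, ‖κ x‖ ≤ K) (s : ℝ) :
    MemLp (fun x => Complex.exp (κ x * s)) ∞ μ := by
  refine memLp_top_of_bound (by fun_prop) (Real.exp (K * |s|)) (.of_forall fun x => ?_)
  rw [Complex.norm_exp]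
  refine Real.exp_le_exp.2 ((Complex.re_le_norm _).trans ?_)
  rw [norm_mul, Complex.norm_real, Real.norm_eq_abs]
  gcongr
  exact hK x

lemma memLp_top_mul_exp_mul {κ : α → ℂ} (hκ : Measurable κ) {K : ℝ} (hK : ∀ x, ‖κ x‖ ≤ K)
    (s : ℝ) : MemLp (fun x => κ x * Complex.exp (κ x * s)) ∞ μ :=
  (memLp_top_exp_mul hκ hK s).mul (memLp_top_of_bound (by fun_prop) K (.of_forall hK))

/-- Boundedness of `κ` makes the second order Taylor remainder uniform in the point, hence the
derivative exists in the `L∞` norm and not only pointwise. -/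
lemma hasDerivAt_toLp_exp_mul {κ : α → ℂ} (hκ : Measurable κ) {K : ℝ} (hK : ∀ x, ‖κ x‖ ≤ K)
    (s : ℝ) :
    HasDerivAt (fun s : ℝ => (memLp_top_exp_mul (μ := μ) hκ hK s).toLp _)
      ((memLp_top_mul_exp_mul (μ := μ) hκ hK s).toLp _) s := by
  rw [hasDerivAt_iff_isLittleO_nhds_zero]
  have hbig : (fun h : ℝ => (memLp_top_exp_mul (μ := μ) hκ hK (s + h)).toLp _ -
      (memLp_top_exp_mul (μ := μ) hκ hK s).toLp _ -
      h • (memLp_top_mul_exp_mul (μ := μ) hκ hK s).toLp _) =O[𝓝 0] fun h : ℝ => h ^ 2 := by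
    refine Asymptotics.IsBigO.of_bound (Real.exp (K * |s|) * K ^ 2) ?_
    have hev : ∀ᶠ h : ℝ in 𝓝 0, K * |h| < 1 := by
      have : ContinuousAt (fun h : ℝ => K * |h|) 0 := by fun_prop
      exact this.eventually_lt_const (by simp)
    filter_upwards [hev] with h hh
    refine Lp.norm_le_of_forall_ae_bound_top (by positivity) ?_
    have h1 := (memLp_top_exp_mul (μ := μ) hκ hK (s + h)).coeFn_toLp
    have h2 := (memLp_top_exp_mul (μ := μ) hκ hK s).coeFn_toLp
    have h3 := (memLp_top_mul_exp_mul (μ := μ) hκ hK s).coeFn_toLp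
    filter_upwards [h1, h2, h3,
      Lp.coeFn_sub ((memLp_top_exp_mul (μ := μ) hκ hK (s + h)).toLp _ -
        (memLp_top_exp_mul (μ := μ) hκ hK s).toLp _)
        (h • (memLp_top_mul_exp_mul (μ := μ) hκ hK s).toLp _),
      Lp.coeFn_sub ((memLp_top_exp_mul (μ := μ) hκ hK (s + h)).toLp _)
        ((memLp_top_exp_mul (μ := μ) hκ hK s).toLp _),
      Lp.coeFn_smul h ((memLp_top_mul_exp_mul (μ := μ) hκ hK s).toLp _)] with x e1 e2 e3 e4 e5 e6
    rw [e4, Pi.sub_apply, e5, Pi.sub_apply, e6, Pi.smul_apply, e1, e2, e3]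
    have hfac : Complex.exp (κ x * ((s + h : ℝ) : ℂ)) - Complex.exp (κ x * s) -
        h • (κ x * Complex.exp (κ x * s)) =
        Complex.exp (κ x * s) * (Complex.exp (κ x * h) - 1 - κ x * h) := by
      rw [Complex.ofReal_add, mul_add, Complex.exp_add, Complex.real_smul]
      ring
    have hle : ‖κ x * (h : ℂ)‖ ≤ K * |h| := by
      rw [norm_mul, Complex.norm_real, Real.norm_eq_abs]
      gcongr
      exact hK x
    rw [hfac, norm_mul, Complex.norm_exp, norm_pow, mul_assoc]
    gcongr
    · refine (Complex.re_le_norm _).trans ?_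
      rw [norm_mul, Complex.norm_real, Real.norm_eq_abs]
      gcongr
      exact hK x
    · refine (Complex.norm_exp_sub_one_sub_id_le (hle.trans hh.le)).trans ?_
      rw [← mul_pow, Real.norm_eq_abs]
      gcongr
  refine hbig.trans_isLittleO ?_
  simpa using Asymptotics.isLittleO_pow_id (𝕜 := ℝ) one_lt_two

/-- Multiplication of `L²` functions by `L∞` functions. -/
noncomputable def mulTop (μ : Measure α) : Lp ℂ ∞ μ →L[ℝ] Lp ℂ 2 μ →L[ℝ] Lp ℂ 2 μ :=
  (ContinuousLinearMap.mul ℝ ℂ).holderL μ ∞ 2 2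

lemma coeFn_mulTop (f : Lp ℂ ∞ μ) (g : Lp ℂ 2 μ) : mulTop μ f g =ᵐ[μ] fun x => f x * g x :=
  (ContinuousLinearMap.mul ℝ ℂ).coeFn_holder f g

lemma coeFn_mulTop_toLp {m : α → ℂ} (hm : MemLp m ∞ μ) (g : Lp ℂ 2 μ) :
    mulTop μ (hm.toLp m) g =ᵐ[μ] fun x => m x * g x := by
  filter_upwards [coeFn_mulTop (hm.toLp m) g, hm.coeFn_toLp] with x h1 h2
  rw [h1, h2]

/-- A factor of `W'' = κ² W` is propagated by `exp (κ t)`. -/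
lemma ae_eq_exp_mul_of_hasDerivAt {κ : α → ℂ} (hκ : Measurable κ) {K : ℝ}
    (hK : ∀ x, ‖κ x‖ ≤ K) {W V A : ℝ → Lp ℂ 2 μ} (hW : ∀ t, HasDerivAt W (V t) t)
    (hV : ∀ t, HasDerivAt V (A t) t) (hA : ∀ t, A t =ᵐ[μ] fun x => κ x ^ 2 * W t x) (T : ℝ) :
    (fun x => κ x * W T x + V T x) =ᵐ[μ]
      fun x => Complex.exp (κ x * T) * (κ x * W 0 x + V 0 x) := by
  have hκ' : MemLp κ ∞ μ := memLp_top_of_bound (by fun_prop) K (.of_forall hK)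
  let e : ℝ → Lp ℂ ∞ μ := fun s => (memLp_top_exp_mul (μ := μ) hκ hK s).toLp _
  let e' : ℝ → Lp ℂ ∞ μ := fun s => (memLp_top_mul_exp_mul (μ := μ) hκ hK s).toLp _
  let Z : ℝ → Lp ℂ 2 μ := fun s => mulTop μ (hκ'.toLp κ) (W s) + V s
  have hZ : ∀ s, HasDerivAt Z (mulTop μ (hκ'.toLp κ) (V s) + A s) s := fun s =>
    ((mulTop μ (hκ'.toLp κ)).hasFDerivAt.comp_hasDerivAt s (hW s)).add (hV s)
  have he : ∀ s, HasDerivAt (fun s => e (T - s)) (-e' (T - s)) s := fun s => by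
    have := (hasDerivAt_toLp_exp_mul (μ := μ) hκ hK (T - s)).scomp s
      ((hasDerivAt_id s).const_sub T)
    rw [neg_one_smul] at this
    exact this
  -- Integrating factor: `Z = κ W + V` satisfies `Z' = κ Z`, so `exp (κ (T - s)) Z(s)` is constant;
  -- the claim compares `s = T` with `s = 0`.
  have hprod : ∀ s, HasDerivAt (fun s => mulTop μ (e (T - s)) (Z s)) 0 s := fun s => by
    convert! (mulTop μ).hasDerivAt_of_bilinear (fun _ => he s) (fun _ => hZ s) using 1
    symm
    rw [Lp.eq_zero_iff_ae_eq_zero, map_neg, neg_apply, ← sub_eq_add_neg]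
    filter_upwards [Lp.coeFn_sub (mulTop μ (e (T - s)) (mulTop μ (hκ'.toLp κ) (V s) + A s))
        (mulTop μ (e' (T - s)) (Z s)),
      coeFn_mulTop_toLp (memLp_top_exp_mul (μ := μ) hκ hK (T - s))
        (mulTop μ (hκ'.toLp κ) (V s) + A s),
      coeFn_mulTop_toLp (memLp_top_mul_exp_mul (μ := μ) hκ hK (T - s)) (Z s),
      Lp.coeFn_add (mulTop μ (hκ'.toLp κ) (V s)) (A s),
      Lp.coeFn_add (mulTop μ (hκ'.toLp κ) (W s)) (V s),
      coeFn_mulTop_toLp hκ' (V s), coeFn_mulTop_toLp hκ' (W s), hA s] with x h1 h2 h3 h4 h5 h6 h7 h8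
    rw [h1, Pi.sub_apply, h2, h3, h4, h5, Pi.add_apply, Pi.add_apply, h6, h7, h8]
    simp only [Pi.zero_apply]
    ring
  have hconst := is_const_of_deriv_eq_zero (fun s => (hprod s).differentiableAt)
    (fun s => (hprod s).deriv) T 0
  have hae : (mulTop μ (e (T - T)) (Z T) : α → ℂ) =ᵐ[μ] mulTop μ (e (T - 0)) (Z 0) := by
    rw [hconst]
  filter_upwards [hae, coeFn_mulTop_toLp (memLp_top_exp_mul (μ := μ) hκ hK (T - T)) (Z T),
    coeFn_mulTop_toLp (memLp_top_exp_mul (μ := μ) hκ hK (T - 0)) (Z 0),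
    Lp.coeFn_add (mulTop μ (hκ'.toLp κ) (W T)) (V T),
    Lp.coeFn_add (mulTop μ (hκ'.toLp κ) (W 0)) (V 0),
    coeFn_mulTop_toLp hκ' (W T), coeFn_mulTop_toLp hκ' (W 0)] with x h1 h2 h3 h4 h5 h6 h7
  rw [h2, h3, h4, h5, Pi.add_apply, Pi.add_apply, h6, h7] at h1
  simpa using h1

/-- Solutions of `W'' = κ² W` with a bounded multiplier `κ` and `W'(0) = 0`. -/
lemma ae_eq_cosh_mul_of_hasDerivAt {κ : α → ℂ} (hκ : Measurable κ) {K : ℝ}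
    (hK : ∀ x, ‖κ x‖ ≤ K) {W V A : ℝ → Lp ℂ 2 μ} (hW : ∀ t, HasDerivAt W (V t) t)
    (hV : ∀ t, HasDerivAt V (A t) t) (hA : ∀ t, A t =ᵐ[μ] fun x => κ x ^ 2 * W t x)
    (hV0 : V 0 = 0) (T : ℝ) :
    ∀ᵐ x ∂μ, κ x ≠ 0 → W T x = Complex.cosh (κ x * T) * W 0 x := by
  have h1 := ae_eq_exp_mul_of_hasDerivAt hκ hK hW hV hA T
  have h2 := ae_eq_exp_mul_of_hasDerivAt hκ.neg (K := K) (by simpa using hK) hW hV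
    (by simpa using hA) T
  have h3 : (V 0 : α → ℂ) =ᵐ[μ] 0 := by rw [hV0]; exact Lp.coeFn_zero _ _ _
  filter_upwards [h1, h2, h3] with x e1 e2 e3 hx
  simp only [Pi.neg_apply] at e2
  rw [e3] at e1 e2
  simp only [Pi.zero_apply, add_zero] at e1 e2
  rw [Complex.cosh, ← neg_mul]
  -- Subtracting the identities for `κ` and `-κ` eliminates `V T`; what remains must be divided by
  -- `2 κ x`, hence the restriction to `κ x ≠ 0`.
  have : (2 * κ x) * W T x =
      (2 * κ x) * ((Complex.exp (κ x * T) + Complex.exp (-κ x * T)) / 2 * W 0 x) := by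
    linear_combination e1 - e2
  exact mul_left_cancel₀ (mul_ne_zero two_ne_zero hx) this

end Multiplier

/-! ### The wave equation on the Fourier side. -/

section FourierSide

open FourierTransform

variable {d : ℕ}

/-- The Laplacian on the Fourier side, for square integrable functions. -/
lemma fourier_ae_eq_of_eq_smul_laplacian {f g : Lp ℂ 2 (volume : Measure (EuclideanSpace ℝ (Fin d)))}
    {k : ℂ} (h : (g : 𝓢'(EuclideanSpace ℝ (Fin d), ℂ)) =
      k • Δ (f : 𝓢'(EuclideanSpace ℝ (Fin d), ℂ))) :
    (𝓕 g : Lp ℂ 2 (volume : Measure (EuclideanSpace ℝ (Fin d)))) =ᵐ[volume]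
      fun ξ => -(k * (2 * Real.pi * ‖ξ‖ : ℝ) ^ 2) *
        (𝓕 f : Lp ℂ 2 (volume : Measure (EuclideanSpace ℝ (Fin d)))) ξ := by
  have h1 : ((𝓕 g : Lp ℂ 2 (volume : Measure (EuclideanSpace ℝ (Fin d)))) :
      𝓢'(EuclideanSpace ℝ (Fin d), ℂ)) = k • (-(2 * Real.pi) ^ 2 : ℝ) •
      TemperedDistribution.smulLeftCLM ℂ (fun x => Complex.ofReal (‖x‖ ^ 2))
        ((𝓕 f : Lp ℂ 2 (volume : Measure (EuclideanSpace ℝ (Fin d)))) :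
          𝓢'(EuclideanSpace ℝ (Fin d), ℂ)) := by
    rw [← Lp.fourier_toTemperedDistribution_eq, h,
      TemperedDistribution.laplacian_eq_fourierMultiplierCLM,
      TemperedDistribution.fourierMultiplierCLM_apply, Lp.fourier_toTemperedDistribution_eq,
      FourierTransform.fourier_smul]
    rw [← Complex.coe_smul, FourierTransform.fourier_smul, FourierTransform.fourier_fourierInv_eq,
      Complex.coe_smul]
  have hl := (Lp.memLp (𝓕 f : Lp ℂ 2 (volume : Measure (EuclideanSpace ℝ (Fin d))))).locallyIntegrable
    one_le_two
  -- An equality of tempered distributions becomes an almost everywhere equality by testing against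
  -- smooth compactly supported functions, which are Schwartz.
  refine ae_eq_of_integral_contDiff_smul_eq
    ((Lp.memLp _).locallyIntegrable one_le_two) ?_ ?_
  · exact LocallyIntegrable.continuous_mul (by fun_prop) hl
  · intro φ hφ hφc
    have hg₁ : HasCompactSupport (Complex.ofRealCLM ∘ φ) := hφc.comp_left rfl
    have hg₂ : ContDiff ℝ ((⊤ : ℕ∞) : WithTop ℕ∞) (Complex.ofRealCLM ∘ φ) := by fun_prop
    have := congrArg (fun T => T (hg₁.toSchwartzMap hg₂)) h1
    have ht : Function.HasTemperateGrowth
        (fun x : EuclideanSpace ℝ (Fin d) => (‖x‖ : ℂ) ^ 2) := by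
      simpa using (show Function.HasTemperateGrowth
        (fun x : EuclideanSpace ℝ (Fin d) => Complex.ofReal (‖x‖ ^ 2)) by fun_prop)
    simp only [Lp.toTemperedDistribution_apply, smul_apply] at this
    simp [SchwartzMap.smulLeftCLM_apply_apply ht] at this
    simp only [Complex.real_smul]
    rw [this, ← integral_const_mul, ← integral_const_mul, ← integral_neg]
    refine integral_congr_ae (.of_forall fun x => ?_)
    push_cast
    ring

/-- The solution of the wave equation on the Fourier side. -/
lemma fourier_wave_ae_eq (hd : 1 ≤ d) {c : ℝ} (hc : c ≠ 0)
    {W V A : ℝ → Lp ℂ 2 (volume : Measure (EuclideanSpace ℝ (Fin d)))}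
    (hW : ∀ t, HasDerivAt W (V t) t) (hV : ∀ t, HasDerivAt V (A t) t) (hV0 : V 0 = 0)
    (hA : ∀ t, (A t : 𝓢'(EuclideanSpace ℝ (Fin d), ℂ)) =
      ((c : ℂ) ^ 2) • Δ (W t : 𝓢'(EuclideanSpace ℝ (Fin d), ℂ))) (t : ℝ) :
    (𝓕 (W t) : Lp ℂ 2 (volume : Measure (EuclideanSpace ℝ (Fin d)))) =ᵐ[volume]
      fun ξ => (Real.cos (c * (2 * Real.pi * ‖ξ‖) * t) : ℂ) *
        (𝓕 (W 0) : Lp ℂ 2 (volume : Measure (EuclideanSpace ℝ (Fin d)))) ξ := by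
  have : Nonempty (Fin d) := ⟨⟨0, hd⟩⟩
  let F := (Lp.fourierTransformₗᵢ (EuclideanSpace ℝ (Fin d)) ℂ).toContinuousLinearEquiv.restrictScalars ℝ
  have hFW : ∀ s, HasDerivAt (fun s => F (W s)) (F (V s)) s := fun s =>
    F.hasFDerivAt.comp_hasDerivAt s (hW s)
  have hFV : ∀ s, HasDerivAt (fun s => F (V s)) (F (A s)) s := fun s =>
    F.hasFDerivAt.comp_hasDerivAt s (hV s)
  have hFA : ∀ s, F (A s) =ᵐ[volume] fun ξ => -((c : ℂ) ^ 2 * (2 * Real.pi * ‖ξ‖ : ℝ) ^ 2) *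
      F (W s) ξ := fun s => fourier_ae_eq_of_eq_smul_laplacian (hA s)
  -- The symbol `i c 2π ‖ξ‖` is unbounded, so the equation is cut off to balls, where the bounded
  -- multiplier lemma applies. The balls exhaust the space, and the origin, where the symbol
  -- vanishes, is null because `d ≥ 1`.
  have hball : ∀ n : ℕ, ∀ᵐ ξ : EuclideanSpace ℝ (Fin d),
      ξ ∈ Metric.closedBall (0 : EuclideanSpace ℝ (Fin d)) n → ξ ≠ 0 →
      F (W t) ξ = (Real.cos (c * (2 * Real.pi * ‖ξ‖) * t) : ℂ) * F (W 0) ξ := fun n => by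
    let S := Metric.closedBall (0 : EuclideanSpace ℝ (Fin d)) n
    have hS : MeasurableSet S := measurableSet_closedBall
    let κ : EuclideanSpace ℝ (Fin d) → ℂ :=
      S.indicator fun ξ => (c * (2 * Real.pi * ‖ξ‖) : ℝ) * Complex.I
    have hκ : Measurable κ := Measurable.indicator (by fun_prop) hS
    have hK : ∀ ξ, ‖κ ξ‖ ≤ |c| * (2 * Real.pi * n) := fun ξ => by
      by_cases hξ : ξ ∈ S
      · simp only [κ, Set.indicator_of_mem hξ, norm_mul, Complex.norm_real, Complex.norm_I,
          Real.norm_eq_abs, abs_norm, mul_one, Nat.abs_ofNat, abs_of_pos Real.pi_pos]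
        gcongr
        simpa [S] using hξ
      · simp only [κ, Set.indicator_of_notMem hξ, norm_zero]
        positivity
    let M := mulTop (volume : Measure (EuclideanSpace ℝ (Fin d)))
      ((memLp_indicator_const ∞ hS (1 : ℂ) (.inr measure_closedBall_lt_top.ne)).toLp _)
    have hM : ∀ f, M f =ᵐ[volume] fun ξ => S.indicator (fun _ => (1 : ℂ)) ξ * f ξ := fun f =>
      coeFn_mulTop_toLp _ f
    have hMW : ∀ s, HasDerivAt (fun s => M (F (W s))) (M (F (V s))) s := fun s =>
      M.hasFDerivAt.comp_hasDerivAt s (hFW s)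
    have hMV : ∀ s, HasDerivAt (fun s => M (F (V s))) (M (F (A s))) s := fun s =>
      M.hasFDerivAt.comp_hasDerivAt s (hFV s)
    have hMA : ∀ s, M (F (A s)) =ᵐ[volume] fun ξ => κ ξ ^ 2 * M (F (W s)) ξ := fun s => by
      filter_upwards [hM (F (A s)), hM (F (W s)), hFA s] with ξ h1 h2 h3
      rw [h1, h2, h3]
      by_cases hξ : ξ ∈ S
      · simp only [κ, Set.indicator_of_mem hξ, mul_pow, Complex.I_sq]
        push_cast
        ring
      · simp [Set.indicator_of_notMem hξ]
    filter_upwards [ae_eq_cosh_mul_of_hasDerivAt hκ hK hMW hMV hMA (by simp [hV0]) t,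
      hM (F (W t)), hM (F (W 0))] with ξ h1 h2 h3 hξ hξ0
    have hκξ : κ ξ = (c * (2 * Real.pi * ‖ξ‖) : ℝ) * Complex.I :=
      Set.indicator_of_mem (s := S) hξ _
    have h4 := h1 (by
      rw [hκξ]
      have := Real.pi_ne_zero
      have := norm_ne_zero_iff.2 hξ0
      simp [*])
    rw [h2, h3, hκξ, Set.indicator_of_mem (s := S) hξ, one_mul, one_mul, mul_right_comm,
      Complex.cosh_mul_I, ← Complex.ofReal_mul, ← Complex.ofReal_cos] at h4
    exact h4
  have hne : ∀ᵐ ξ : EuclideanSpace ℝ (Fin d), ξ ≠ 0 := Measure.ae_ne volume 0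
  filter_upwards [ae_all_iff.2 hball, hne] with ξ h hξ
  obtain ⟨n, hn⟩ := exists_nat_ge ‖ξ‖
  exact h n (by simpa using hn) hξ

end FourierSide

/-! ### Averaging a wave over a probability measure in time. -/

section Averaging

open FourierTransform

variable {d : ℕ}

/-- On a probability space the `L¹` norm is at most the `L²` norm; applied to each section, this
reduces both claims to Tonelli. -/
lemma memLp_two_integral_of_prod {α β : Type*} [MeasurableSpace α] [MeasurableSpace β]
    {μ : Measure α} [SFinite μ] {ν : Measure β} [IsProbabilityMeasure ν] {f : α × β → ℂ}
    (hf : Measurable f) (h : MemLp f 2 (μ.prod ν)) :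
    (∀ᵐ x ∂μ, Integrable (fun y => f (x, y)) ν) ∧ MemLp (fun x => ∫ y, f (x, y) ∂ν) 2 μ := by
  have hlt : ∫⁻ x, ∫⁻ y, ‖f (x, y)‖ₑ ^ 2 ∂ν ∂μ < ∞ := by
    rw [← lintegral_prod (fun z => ‖f z‖ₑ ^ 2) (by fun_prop)]
    have := lintegral_rpow_enorm_lt_top_of_eLpNorm_lt_top two_ne_zero ENNReal.ofNat_ne_top h.2
    simpa using this
  have hae := ae_lt_top (by fun_prop) hlt.ne
  have hsec : ∀ x, Measurable fun y => f (x, y) := fun x => hf.comp measurable_prodMk_left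
  have hsq : ∀ x, eLpNorm (fun y => f (x, y)) 2 ν ^ 2 = ∫⁻ y, ‖f (x, y)‖ₑ ^ 2 ∂ν := fun x => by
    have := eLpNorm_nnreal_pow_eq_lintegral (f := fun y => f (x, y)) (μ := ν) (p := 2) two_ne_zero
    simpa using this
  have hint : ∀ᵐ x ∂μ, Integrable (fun y => f (x, y)) ν := by
    filter_upwards [hae] with x hx
    rw [← hsq] at hx
    exact MemLp.integrable one_le_two ⟨(hsec x).aestronglyMeasurable, by
      simpa using hx⟩
  refine ⟨hint, hf.stronglyMeasurable.integral_prod_right'.aestronglyMeasurable, ?_⟩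
  have hle : eLpNorm (fun x => ∫ y, f (x, y) ∂ν) 2 μ ^ 2 ≤ ∫⁻ x, ∫⁻ y, ‖f (x, y)‖ₑ ^ 2 ∂ν ∂μ := by
    have := eLpNorm_nnreal_pow_eq_lintegral (f := fun x => ∫ y, f (x, y) ∂ν) (μ := μ) (p := 2)
      two_ne_zero
    simp only [ENNReal.coe_ofNat, NNReal.coe_ofNat, ENNReal.rpow_ofNat] at this
    rw [this]
    refine lintegral_mono fun x => ?_
    rw [← hsq]
    gcongr
    refine (enorm_integral_le_lintegral_enorm _).trans ?_
    rw [← eLpNorm_one_eq_lintegral_enorm]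
    exact eLpNorm_le_eLpNorm_of_exponent_le one_le_two (hsec x).aestronglyMeasurable
  simpa using hle.trans_lt hlt

lemma memLp_two_prod_of_forall {α β : Type*} [MeasurableSpace α] [MeasurableSpace β]
    {μ : Measure α} [SFinite μ] {ν : Measure β} [IsProbabilityMeasure ν] {f : α × β → ℂ}
    (hf : Measurable f) {C : ℝ≥0} (h : ∀ y, eLpNorm (fun x => f (x, y)) 2 μ ≤ C) :
    MemLp f 2 (μ.prod ν) := by
  refine ⟨hf.aestronglyMeasurable, ?_⟩
  have h1 := eLpNorm_nnreal_pow_eq_lintegral (f := f) (μ := μ.prod ν) (p := 2) two_ne_zero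
  simp only [ENNReal.coe_ofNat, NNReal.coe_ofNat, ENNReal.rpow_ofNat] at h1
  have h2 : eLpNorm f 2 (μ.prod ν) ^ 2 ≤ (C : ℝ≥0∞) ^ 2 := by
    rw [h1, lintegral_prod_symm' _ (by fun_prop)]
    calc ∫⁻ y, ∫⁻ x, ‖f (x, y)‖ₑ ^ 2 ∂μ ∂ν ≤ ∫⁻ _, (C : ℝ≥0∞) ^ 2 ∂ν := by
          refine lintegral_mono fun y => ?_
          have h3 := eLpNorm_nnreal_pow_eq_lintegral (f := fun x => f (x, y)) (μ := μ) (p := 2)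
            two_ne_zero
          simp only [ENNReal.coe_ofNat, NNReal.coe_ofNat, ENNReal.rpow_ofNat] at h3
          rw [← h3]
          gcongr
          exact h y
      _ = (C : ℝ≥0∞) ^ 2 := by simp
  have h3 : (C : ℝ≥0∞) ^ 2 < ∞ := by finiteness
  simpa using h2.trans_lt h3

/-- Averages in time of a wave are `L²` functions, and the averaging acts on the Fourier side by
the cosine transform of the averaging measure. -/
lemma wave_average {k : ℝ} {w : ℝ → EuclideanSpace ℝ (Fin d) → ℂ}
    (hw : Measurable (Function.uncurry w))
    {W : ℝ → Lp ℂ 2 (volume : Measure (EuclideanSpace ℝ (Fin d)))} (hWw : ∀ t, W t =ᵐ[volume] w t)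
    (hF : ∀ t, (𝓕 (W t) : Lp ℂ 2 (volume : Measure (EuclideanSpace ℝ (Fin d)))) =ᵐ[volume]
      fun ξ => (Real.cos (k * (2 * Real.pi * ‖ξ‖) * t) : ℂ) *
        (𝓕 (W 0) : Lp ℂ 2 (volume : Measure (EuclideanSpace ℝ (Fin d)))) ξ)
    (μ : Measure ℝ) [IsProbabilityMeasure μ] :
    (∀ᵐ x, Integrable (fun s => w s x) μ) ∧
    ∃ v : Lp ℂ 2 (volume : Measure (EuclideanSpace ℝ (Fin d))),
      v =ᵐ[volume] (fun x => ∫ s, w s x ∂μ) ∧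
      (𝓕 v : Lp ℂ 2 (volume : Measure (EuclideanSpace ℝ (Fin d)))) =ᵐ[volume]
        fun ξ => ((∫ s, Real.cos (k * (2 * Real.pi * ‖ξ‖) * s) ∂μ : ℝ) : ℂ) *
          (𝓕 (W 0) : Lp ℂ 2 (volume : Measure (EuclideanSpace ℝ (Fin d)))) ξ := by
  let E := EuclideanSpace ℝ (Fin d)
  let G : Lp ℂ 2 (volume : Measure E) := 𝓕 (W 0)
  let φ : E × ℝ → ℂ := fun z => w z.2 z.1
  have hφ : Measurable φ := hw.comp measurable_swap
  have hnorm : ∀ s, ‖W s‖ ≤ ‖W 0‖ := fun s => by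
    rw [← Lp.norm_fourier_eq (W s), ← Lp.norm_fourier_eq (W 0)]
    refine Lp.norm_le_norm_of_ae_le ?_
    filter_upwards [hF s] with ξ h
    rw [h, norm_mul, Complex.norm_real]
    exact mul_le_of_le_one_left (norm_nonneg _) (Real.abs_cos_le_one _)
  have hφL : MemLp φ 2 ((volume : Measure E).prod μ) := by
    refine memLp_two_prod_of_forall hφ (C := ‖W 0‖₊) fun s => ?_
    rw [eLpNorm_congr_ae (hWw s).symm, ← Lp.enorm_def, enorm_eq_nnnorm]
    exact_mod_cast hnorm s
  obtain ⟨hint, hv⟩ := memLp_two_integral_of_prod hφ hφL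
  refine ⟨hint, hv.toLp _, hv.coeFn_toLp, ?_⟩
  let ψ : E × ℝ → ℂ := fun z => (Real.cos (k * (2 * Real.pi * ‖z.1‖) * z.2) : ℂ) * G z.1
  have hcosm : Measurable fun z : E × ℝ => (Real.cos (k * (2 * Real.pi * ‖z.1‖) * z.2) : ℂ) := by
    fun_prop
  have hψL : MemLp ψ 2 ((volume : Measure E).prod μ) := by
    refine MemLp.of_le ((Lp.memLp G).comp_fst μ) (hcosm.aestronglyMeasurable.mul
      (Lp.aestronglyMeasurable G).comp_fst) (.of_forall fun z => ?_)
    rw [norm_mul, Complex.norm_real]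
    exact mul_le_of_le_one_left (norm_nonneg _) (Real.abs_cos_le_one _)
  have hm : MemLp (fun ξ : E => ((∫ s, Real.cos (k * (2 * Real.pi * ‖ξ‖) * s) ∂μ : ℝ) : ℂ) * G ξ) 2
      volume := by
    have hmeas : StronglyMeasurable fun ξ : E => ∫ s, Real.cos (k * (2 * Real.pi * ‖ξ‖) * s) ∂μ :=
      StronglyMeasurable.integral_prod_right'
        (f := fun z : E × ℝ => Real.cos (k * (2 * Real.pi * ‖z.1‖) * z.2))
        (Measurable.stronglyMeasurable (by fun_prop))
    refine MemLp.of_le (Lp.memLp G) ((Complex.continuous_ofReal.comp_stronglyMeasurable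
      hmeas).aestronglyMeasurable.mul (Lp.aestronglyMeasurable G)) (.of_forall fun ξ => ?_)
    rw [norm_mul, Complex.norm_real]
    refine mul_le_of_le_one_left (norm_nonneg _) ?_
    refine (norm_integral_le_of_norm_le_const (C := 1)
      (.of_forall fun s => Real.abs_cos_le_one _)).trans_eq (by simp)
  -- Both sides are tested against an arbitrary `𝓕 g`. Fubini moves the time average outside each
  -- pairing, and Parseval identifies the pairings at each fixed time, so no vector-valued integral
  -- is needed.
  have key : (𝓕 (hv.toLp _) : Lp ℂ 2 (volume : Measure E)) = hm.toLp _ := by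
    refine ext_inner_left ℂ fun g' => ?_
    obtain ⟨g, rfl⟩ := (Lp.fourierTransformₗᵢ E ℂ).surjective g'
    change inner ℂ (𝓕 g) _ = inner ℂ (𝓕 g) _
    rw [Lp.inner_fourier_eq]
    have e1 : inner ℂ g (hv.toLp _) = ∫ s, inner ℂ g (W s) ∂μ := by
      have hI : Integrable (fun z : E × ℝ => star (g z.1) * φ z) ((volume : Measure E).prod μ) :=
        MemLp.integrable_mul ((Lp.memLp g).comp_fst μ).star hφL
      calc inner ℂ g (hv.toLp _) = ∫ x, ∫ s, star (g x) * φ (x, s) ∂μ := by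
            rw [L2.inner_def]
            refine integral_congr_ae ?_
            filter_upwards [hv.coeFn_toLp] with x hx
            rw [hx, integral_const_mul, RCLike.inner_apply, mul_comm]
            rfl
        _ = ∫ s, (∫ x : E, star (g x) * φ (x, s)) ∂μ := integral_integral_swap hI
        _ = ∫ s, inner ℂ g (W s) ∂μ := by
            refine integral_congr_ae (.of_forall fun s => ?_)
            dsimp only
            rw [L2.inner_def]
            refine integral_congr_ae ?_
            filter_upwards [hWw s] with x hx
            rw [hx, RCLike.inner_apply, mul_comm]
            rfl
    have e2 : inner ℂ (𝓕 g) (hm.toLp _) = ∫ s, inner ℂ (𝓕 g) (𝓕 (W s)) ∂μ := by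
      have hI : Integrable (fun z : E × ℝ => star ((𝓕 g : Lp ℂ 2 (volume : Measure E)) z.1) * ψ z)
          ((volume : Measure E).prod μ) :=
        MemLp.integrable_mul ((Lp.memLp (𝓕 g : Lp ℂ 2 (volume : Measure E))).comp_fst μ).star hψL
      calc inner ℂ (𝓕 g) (hm.toLp _) =
            ∫ x, ∫ s, star ((𝓕 g : Lp ℂ 2 (volume : Measure E)) x) * ψ (x, s) ∂μ := by
            rw [L2.inner_def]
            refine integral_congr_ae ?_
            filter_upwards [hm.coeFn_toLp] with x hx
            rw [hx, integral_const_mul, RCLike.inner_apply, mul_comm]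
            simp only [ψ]
            rw [integral_mul_const, integral_complex_ofReal]
            rfl
        _ = ∫ s, (∫ x : E, star ((𝓕 g : Lp ℂ 2 (volume : Measure E)) x) * ψ (x, s)) ∂μ :=
            integral_integral_swap hI
        _ = ∫ s, inner ℂ (𝓕 g) (𝓕 (W s)) ∂μ := by
            refine integral_congr_ae (.of_forall fun s => ?_)
            dsimp only
            rw [L2.inner_def]
            refine integral_congr_ae ?_
            filter_upwards [hF s] with x hx
            rw [hx, RCLike.inner_apply, mul_comm]
            rfl
    rw [e1, e2]
    simp_rw [Lp.inner_fourier_eq]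
  rw [key]
  exact hm.coeFn_toLp

end Averaging

/-! ### Uniform comparison of the telegraph equation with the heat profile. -/

section Telegraph

/-- The system solved by `p = 𝔼[cos (l τ)]`, `q = 𝔼[(-1)^N sin (l τ)]`; it is equivalent to the
telegraph equation `p'' + 2 a p' + l² p = 0`, `p(0) = 1`, `p'(0) = 0`. -/
structure IsTelegraphSystem (a l t : ℝ) (p q : ℝ → ℝ) : Prop where
  cont_p : ContinuousOn p (Set.Icc 0 t)
  cont_q : ContinuousOn q (Set.Icc 0 t)
  deriv_p : ∀ x ∈ Set.Ico 0 t, HasDerivWithinAt p (-(l * q x)) (Set.Ici x) x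
  deriv_q : ∀ x ∈ Set.Ico 0 t, HasDerivWithinAt q (l * p x - 2 * a * q x) (Set.Ici x) x
  p_zero : p 0 = 1
  q_zero : q 0 = 0

variable {a l t : ℝ} {p q : ℝ → ℝ}

lemma hasDerivWithinAt_exp_const_mul (m x : ℝ) (s : Set ℝ) :
    HasDerivWithinAt (fun x => Real.exp (m * x)) (m * Real.exp (m * x)) s x := by
  have := (((hasDerivAt_id x).const_mul m).exp).hasDerivWithinAt (s := s)
  simpa [mul_comm] using this

lemma Real.exp_neg_le_inv {x : ℝ} (hx : 0 < x) : Real.exp (-x) ≤ 1 / x := by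
  rw [Real.exp_neg, inv_eq_one_div]
  exact one_div_le_one_div_of_le hx (by linarith [Real.add_one_le_exp x])

lemma Real.mul_exp_neg_le_one (x : ℝ) : x * Real.exp (-x) ≤ 1 := by
  have h := Real.add_one_le_exp x
  have h2 : Real.exp x * Real.exp (-x) = 1 := by rw [← Real.exp_add]; simp
  nlinarith [Real.exp_pos (-x)]

lemma Real.sq_mul_exp_neg_le_two {x : ℝ} (hx : 0 ≤ x) : x ^ 2 * Real.exp (-x) ≤ 2 := by
  have h := Real.quadratic_le_exp_of_nonneg hx
  have h2 : Real.exp x * Real.exp (-x) = 1 := by rw [← Real.exp_add]; simp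
  nlinarith [Real.exp_pos (-x)]

namespace IsTelegraphSystem

/-- First integrals along the eigendirections. -/
lemma first_integral (h : IsTelegraphSystem a l t p q) (ht : 0 ≤ t) {m n : ℝ}
    (hmn : m + n = -2 * a) (hmn' : m * n = l ^ 2) :
    -(l * q t) - n * p t = -n * Real.exp (m * t) := by
  -- With `m`, `n` the roots of `z² + 2 a z + l²` and `p' = -l q`, the combination `p' - n p`
  -- satisfies `y' = m y`, so its product with `exp (-m x)` is constant.
  have hc := constant_of_has_deriv_right_zero (a := 0) (b := t)
    (f := fun x => (-(l * q x) - n * p x) * Real.exp (-m * x))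
    (ContinuousOn.mul (((h.cont_q.const_mul l).neg).sub (h.cont_p.const_mul n))
      (by fun_prop))
    (fun x hx => by
      have h1 := (((((h.deriv_q x hx).const_mul l).neg).sub
        ((h.deriv_p x hx).const_mul n)).mul (hasDerivWithinAt_exp_const_mul (-m) x (Set.Ici x)))
      convert! h1 using 1
      simp only [Pi.sub_apply, Pi.neg_apply]
      linear_combination Real.exp (-m * x) * (-(l * q x * hmn) - p x * hmn'))
    t (Set.right_mem_Icc.2 ht)
  simp only [h.p_zero, h.q_zero, mul_zero, neg_zero, Real.exp_zero, mul_one, zero_sub] at hc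
  have h2 : Real.exp (-m * t) * Real.exp (m * t) = 1 := by rw [← Real.exp_add]; simp
  linear_combination (-(l * q t) - n * p t) * (-h2) + Real.exp (m * t) * hc

/-- The roots are `-δ` and `-(a + r)`, with `r = √(a² - l²) ≥ a / 2`. The slow rate `δ` exceeds the
heat rate `ν = l² / (2a)` by `δ² / (2a) ≤ 2 ν² / a`, and `(ν t)² exp (-(ν t)) ≤ 2` turns this into
`4 / (a t)`. The correction with coefficient `δ / (2r)` costs `1 / (a t)` because `x exp (-x) ≤ 1`.
-/
lemma abs_sub_exp_le_of_overdamped (h : IsTelegraphSystem a l t p q) (ha : 0 < a) (ht : 0 < t)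
    (hl : 4 * l ^ 2 ≤ a ^ 2) :
    |p t - Real.exp (-(l ^ 2 * t / (2 * a)))| ≤ 5 / (a * t) := by
  set r := Real.sqrt (a ^ 2 - l ^ 2) with hr
  have hr2 : r ^ 2 = a ^ 2 - l ^ 2 := Real.sq_sqrt (by nlinarith)
  have hr0 : 0 ≤ r := Real.sqrt_nonneg _
  have hra : r ≤ a := by nlinarith [sq_nonneg l]
  have har : a / 2 ≤ r := by nlinarith
  have h1 := h.first_integral ht.le (m := -a + r) (n := -a - r) (by ring) (by linear_combination -hr2)
  have h2 := h.first_integral ht.le (m := -a - r) (n := -a + r) (by ring) (by linear_combination -hr2)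
  set δ := a - r with hδ
  set ν := l ^ 2 / (2 * a) with hν
  have hδ0 : 0 ≤ δ := by linarith
  have hν0 : 0 ≤ ν := by positivity
  have hl2 : l ^ 2 = 2 * a * ν := by rw [hν]; field_simp
  have hδr : δ * (a + r) = 2 * a * ν := by rw [← hl2]; linear_combination -hr2
  have hνδ : ν ≤ δ := by nlinarith
  have hδν : δ ≤ 2 * ν := by nlinarith
  have hdiff : δ - ν ≤ 2 * ν ^ 2 / a := by
    rw [le_div_iff₀ ha]
    nlinarith
  have e1 : (-a + r) * t = -(δ * t) := by rw [hδ]; ring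
  have e2 : (-a - r) * t = -((a + r) * t) := by ring
  rw [e1] at h1
  rw [e2] at h2
  have hp : p t = Real.exp (-(δ * t)) + δ / (2 * r) *
      (Real.exp (-(δ * t)) - Real.exp (-((a + r) * t))) := by
    have hr' : 2 * r ≠ 0 := by linarith
    refine mul_left_cancel₀ hr' ?_
    rw [mul_add, ← mul_assoc (2 * r) (δ / (2 * r)), mul_div_cancel₀ _ hr', hδ]
    linear_combination h1 - h2
  have e3 : l ^ 2 * t / (2 * a) = ν * t := by rw [hν]; ring
  rw [hp, e3]
  have b1 : |Real.exp (-(δ * t)) - Real.exp (-(ν * t))| ≤ 4 / (a * t) := by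
    have hle : Real.exp (-(δ * t)) ≤ Real.exp (-(ν * t)) := by
      apply Real.exp_le_exp.2; nlinarith
    rw [abs_sub_comm, abs_of_nonneg (by linarith)]
    have hs : Real.exp (-(δ * t)) = Real.exp (-(ν * t)) * Real.exp (-((δ - ν) * t)) := by
      rw [← Real.exp_add]; ring_nf
    have hb := Real.add_one_le_exp (-((δ - ν) * t))
    have hsq := Real.sq_mul_exp_neg_le_two (mul_nonneg hν0 ht.le)
    rw [hs]
    calc Real.exp (-(ν * t)) - Real.exp (-(ν * t)) * Real.exp (-((δ - ν) * t))
        = Real.exp (-(ν * t)) * (1 - Real.exp (-((δ - ν) * t))) := by ring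
      _ ≤ Real.exp (-(ν * t)) * (2 * ν ^ 2 / a * t) := by
          gcongr
          nlinarith
      _ = 2 * ((ν * t) ^ 2 * Real.exp (-(ν * t))) / (a * t) := by
          field_simp
      _ ≤ 2 * 2 / (a * t) := by gcongr
      _ = 4 / (a * t) := by norm_num
  have b2 : |δ / (2 * r) * (Real.exp (-(δ * t)) - Real.exp (-((a + r) * t)))| ≤ 1 / (a * t) := by
    have hle : Real.exp (-((a + r) * t)) ≤ Real.exp (-(δ * t)) := by
      apply Real.exp_le_exp.2; nlinarith
    have hpos := Real.exp_pos (-((a + r) * t))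
    rw [abs_of_nonneg (mul_nonneg (by positivity) (by linarith))]
    have hm := Real.mul_exp_neg_le_one (δ * t)
    calc δ / (2 * r) * (Real.exp (-(δ * t)) - Real.exp (-((a + r) * t)))
        ≤ δ / a * Real.exp (-(δ * t)) := by
          have : δ / (2 * r) ≤ δ / a := by gcongr; linarith
          gcongr
          linarith
      _ = (δ * t * Real.exp (-(δ * t))) / (a * t) := by field_simp
      _ ≤ 1 / (a * t) := by gcongr
  calc _ = |(Real.exp (-(δ * t)) - Real.exp (-(ν * t))) +
        δ / (2 * r) * (Real.exp (-(δ * t)) - Real.exp (-((a + r) * t)))| := by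
        congr 1; ring
    _ ≤ 4 / (a * t) + 1 / (a * t) := (abs_add_le _ _).trans (add_le_add b1 b2)
    _ = 5 / (a * t) := by ring

/-- Exponential decay of the energy when the frequency is not small. -/
lemma abs_le_of_underdamped (h : IsTelegraphSystem a l t p q) (ha : 0 < a) (ht : 0 < t)
    (hl : a ^ 2 < 4 * l ^ 2) : |p t| ≤ 39 / (a * t) := by
  -- The energy is `E = (p' + a p)² + (l² + a²) p²`, for which `E' = -2a (p'² + l² p²)`. When `a² <
  -- 4 l²`, `E ≤ 13 (p'² + l² p²)`, so `E` decays at rate `k = 2a / 13`. As `E(0) = l² + 2a² ≤ 9 l²`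
  -- and `l² p² ≤ E`, this gives `|p| ≤ 3 exp (-(a t / 13)) ≤ 39 / (a t)`.
  have hl0 : 0 < l ^ 2 := by nlinarith [sq_nonneg a]
  let k := 2 * a / 13
  have hE := image_le_of_deriv_right_le_deriv_boundary (a := 0) (b := t)
    (f := fun x => ((-(l * q x) + a * p x) ^ 2 + (l ^ 2 + a ^ 2) * p x ^ 2) * Real.exp (k * x))
    (f' := fun x => (2 * (-(l * q x) + a * p x) *
      (-(l * (l * p x - 2 * a * q x)) + a * (-(l * q x))) +
      (l ^ 2 + a ^ 2) * (2 * p x * (-(l * q x)))) * Real.exp (k * x) +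
      ((-(l * q x) + a * p x) ^ 2 + (l ^ 2 + a ^ 2) * p x ^ 2) * (k * Real.exp (k * x)))
    (B := fun _ => l ^ 2 + 2 * a ^ 2) (B' := fun _ => 0)
    (ContinuousOn.mul ((((h.cont_q.const_mul l).neg.add (h.cont_p.const_mul a)).pow 2).add
      ((h.cont_p.pow 2).const_mul _)) (by fun_prop))
    (fun x hx => by
      have h1 := ((((((h.deriv_q x hx).const_mul l).neg.add
        ((h.deriv_p x hx).const_mul a)).pow 2).add
        (((h.deriv_p x hx).pow 2).const_mul (l ^ 2 + a ^ 2))).mul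
          (hasDerivWithinAt_exp_const_mul k x (Set.Ici x)))
      convert! h1 using 1
      simp)
    (by simp [h.p_zero, h.q_zero]; linarith)
    continuousOn_const (fun x _ => hasDerivWithinAt_const x _ _)
    (fun x hx => by
      have hexp := Real.exp_pos (k * x)
      have : (2 * (-(l * q x) + a * p x) *
        (-(l * (l * p x - 2 * a * q x)) + a * (-(l * q x))) +
        (l ^ 2 + a ^ 2) * (2 * p x * (-(l * q x)))) +
        ((-(l * q x) + a * p x) ^ 2 + (l ^ 2 + a ^ 2) * p x ^ 2) * k ≤ 0 := by
        set y := l * q x with hy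
        have e : (2 * (-y + a * p x) *
          (-(l * (l * p x - 2 * a * q x)) + a * (-y)) +
          (l ^ 2 + a ^ 2) * (2 * p x * (-y))) = -(2 * a) * (y ^ 2 + l ^ 2 * p x ^ 2) := by
          rw [hy]; ring
        have e2 : (-y + a * p x) ^ 2 + (l ^ 2 + a ^ 2) * p x ^ 2 ≤
            13 * (y ^ 2 + l ^ 2 * p x ^ 2) := by
          nlinarith [sq_nonneg (y + a * p x), sq_nonneg y, sq_nonneg (p x),
            mul_le_mul_of_nonneg_right hl.le (sq_nonneg (p x))]
        have hk : 0 < k := by positivity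
        have : k * 13 = 2 * a := by simp [k]
        have e3 := mul_le_mul_of_nonneg_right e2 hk.le
        rw [e]
        linear_combination e3 + (y ^ 2 + l ^ 2 * p x ^ 2) * this
      have := mul_nonpos_of_nonpos_of_nonneg this hexp.le
      linarith)
    (Set.right_mem_Icc.2 ht.le)
  beta_reduce at hE
  have hpos := Real.exp_pos (k * t)
  have h1 : (p t) ^ 2 * Real.exp (k * t) ≤ 9 := by
    have : l ^ 2 * ((p t) ^ 2 * Real.exp (k * t)) ≤ l ^ 2 * 9 := by
      have : 0 ≤ ((-(l * q t) + a * p t) ^ 2 + a ^ 2 * p t ^ 2) * Real.exp (k * t) := by positivity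
      nlinarith
    exact le_of_mul_le_mul_left this hl0
  have h2 : Real.exp (k * t) = Real.exp (a * t / 13) ^ 2 := by
    rw [← Real.exp_nat_mul]; congr 1; simp [k]; ring
  rw [h2, ← mul_pow, show (9 : ℝ) = 3 ^ 2 by norm_num] at h1
  have h3 := abs_le_of_sq_le_sq h1 (by norm_num)
  have h4 : |p t| * Real.exp (a * t / 13) ≤ 3 := by
    rw [← abs_of_pos (Real.exp_pos (a * t / 13)), ← abs_mul]
    exact h3
  have h5 := Real.add_one_le_exp (a * t / 13)
  rw [le_div_iff₀ (by positivity)]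
  nlinarith [abs_nonneg (p t)]

/-- The frequencies split at `2|l| = a`. Above the threshold the two terms are not compared but
bounded separately: the heat exponent exceeds `a t / 8`, which gives `47 = 39 + 8`. -/
lemma abs_sub_exp_le (h : IsTelegraphSystem a l t p q) (ha : 0 < a) (ht : 0 < t) :
    |p t - Real.exp (-(l ^ 2 * t / (2 * a)))| ≤ 47 / (a * t) := by
  have hat : 0 < a * t := by positivity
  rcases le_or_gt (4 * l ^ 2) (a ^ 2) with hl | hl
  · refine (h.abs_sub_exp_le_of_overdamped ha ht hl).trans ?_
    gcongr
    norm_num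
  · have h1 := h.abs_le_of_underdamped ha ht hl
    have h2 : Real.exp (-(l ^ 2 * t / (2 * a))) ≤ 8 / (a * t) := by
      calc Real.exp (-(l ^ 2 * t / (2 * a))) ≤ Real.exp (-(a * t / 8)) := by
            apply Real.exp_le_exp.2
            rw [neg_le_neg_iff, div_le_div_iff₀ (by norm_num) (by positivity)]
            nlinarith
        _ ≤ 1 / (a * t / 8) := Real.exp_neg_le_inv (by positivity)
        _ = 8 / (a * t) := by field_simp
    calc _ ≤ |p t| + |Real.exp (-(l ^ 2 * t / (2 * a)))| := abs_sub _ _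
      _ ≤ 39 / (a * t) + 8 / (a * t) := by
          rw [abs_of_pos (Real.exp_pos _)]; exact add_le_add h1 h2
      _ = 47 / (a * t) := by ring

end IsTelegraphSystem

end Telegraph

/-! ### Deterministic estimates along a counting path. -/

section Paths

/-- The time integral `∫₀ᵗ (-1)^{n(s)} ds` along a path `n`. -/
noncomputable def signIntegral (n : ℝ≥0 → ℕ) (t : ℝ) : ℝ :=
  ∫ s in (0 : ℝ)..t, (-1 : ℝ) ^ n s.toNNReal

variable {n : ℝ≥0 → ℕ}

lemma abs_neg_one_pow_real (k : ℕ) : |(-1 : ℝ) ^ k| = 1 := by simp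

lemma measurable_sign_path (hn : Monotone n) : Measurable fun s : ℝ => (-1 : ℝ) ^ n s.toNNReal :=
  (measurable_of_countable fun k : ℕ => (-1 : ℝ) ^ k).comp
    (hn.comp fun _ _ h => Real.toNNReal_mono h).measurable

lemma intervalIntegrable_sign_path (hn : Monotone n) (x y : ℝ) :
    IntervalIntegrable (fun s : ℝ => (-1 : ℝ) ^ n s.toNNReal) volume x y := by
  rw [intervalIntegrable_iff]
  refine Measure.integrableOn_of_bounded (M := 1) (by simp)
    (measurable_sign_path hn).aestronglyMeasurable (.of_forall fun s => ?_)
  rw [Real.norm_eq_abs, abs_neg_one_pow_real]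

lemma signIntegral_sub (hn : Monotone n) (x y : ℝ) :
    signIntegral n y - signIntegral n x = ∫ s in x..y, (-1 : ℝ) ^ n s.toNNReal :=
  intervalIntegral.integral_interval_sub_left (intervalIntegrable_sign_path hn _ _)
    (intervalIntegrable_sign_path hn _ _)

lemma abs_signIntegral_sub_le (hn : Monotone n) (x y : ℝ) :
    |signIntegral n y - signIntegral n x| ≤ |y - x| := by
  rw [signIntegral_sub hn, ← Real.norm_eq_abs, ← one_mul |y - x|]
  exact intervalIntegral.norm_integral_le_of_norm_le_const fun s _ => by simp

/-- The right endpoint Riemann sums of the time integral. -/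
noncomputable def signRiemannSum (n : ℝ≥0 → ℕ) (t : ℝ≥0) (m : ℕ) : ℝ :=
  ∑ k ∈ Finset.range (m + 1), (t / (m + 1) : ℝ) * (-1 : ℝ) ^ n (t * (k + 1) / (m + 1))

lemma abs_neg_one_pow_sub_le {i j : ℕ} (h : i ≤ j) :
    |(-1 : ℝ) ^ i - (-1 : ℝ) ^ j| ≤ 2 * ((j : ℝ) - i) := by
  rcases h.eq_or_lt with rfl | h
  · simp
  · have h1 : (i : ℝ) + 1 ≤ j := by exact_mod_cast h
    calc _ ≤ |(-1 : ℝ) ^ i| + |(-1 : ℝ) ^ j| := abs_sub _ _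
      _ ≤ _ := by rw [abs_neg_one_pow_real, abs_neg_one_pow_real]; linarith

/-- On each cell the sign differs from its right endpoint value by at most twice the increase of `n`
over the cell. These increases telescope, so monotonicity alone gives a rate, with no description of
the jump times. -/
lemma abs_signIntegral_sub_riemannSum_le (hn : Monotone n) (t : ℝ≥0) (m : ℕ) :
    |signIntegral n t - signRiemannSum n t m| ≤ 2 * n t * t / (m + 1) := by
  let g : ℕ → ℝ≥0 := fun k => t * k / (m + 1)
  have hg : Monotone g := fun i j hij => by
    simp only [g]
    gcongr
  have hg0 : g 0 = 0 := by simp [g]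
  have hgm : g (m + 1) = t := by
    simp only [g]
    push_cast
    field_simp
  have hgs : ∀ k, (g (k + 1) : ℝ) - g k = t / (m + 1) := fun k => by
    simp only [g]
    push_cast
    ring
  have hsum : signIntegral n t = ∑ k ∈ Finset.range (m + 1),
      ∫ s in (g k : ℝ)..g (k + 1), (-1 : ℝ) ^ n s.toNNReal := by
    rw [intervalIntegral.sum_integral_adjacent_intervals (a := fun k => (g k : ℝ))
      fun k _ => intervalIntegrable_sign_path hn _ _, hgm, hg0]
    rfl
  have hterm : ∀ k, |(∫ s in (g k : ℝ)..g (k + 1), (-1 : ℝ) ^ n s.toNNReal) -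
      (t / (m + 1) : ℝ) * (-1 : ℝ) ^ n (g (k + 1))| ≤
      2 * ((n (g (k + 1)) : ℝ) - n (g k)) * (t / (m + 1)) := fun k => by
    have hle : (g k : ℝ) ≤ g (k + 1) := hg k.le_succ
    have : (∫ s in (g k : ℝ)..g (k + 1), (-1 : ℝ) ^ n s.toNNReal) -
        (t / (m + 1) : ℝ) * (-1 : ℝ) ^ n (g (k + 1)) =
        ∫ s in (g k : ℝ)..g (k + 1), ((-1 : ℝ) ^ n s.toNNReal - (-1 : ℝ) ^ n (g (k + 1))) := by
      rw [intervalIntegral.integral_sub (intervalIntegrable_sign_path hn _ _) (by simp),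
        intervalIntegral.integral_const, hgs, smul_eq_mul]
    rw [this, ← Real.norm_eq_abs, ← hgs k,
      ← abs_of_nonneg (show 0 ≤ (g (k + 1) : ℝ) - g k by linarith)]
    refine intervalIntegral.norm_integral_le_of_norm_le_const fun s hs => ?_
    rw [Set.uIoc_of_le hle] at hs
    have h1 : g k ≤ s.toNNReal := NNReal.le_toNNReal_of_coe_le hs.1.le
    have h2 : s.toNNReal ≤ g (k + 1) := Real.toNNReal_le_iff_le_coe.2 hs.2
    refine (abs_neg_one_pow_sub_le (hn h2)).trans ?_
    have : (n (g k) : ℝ) ≤ n s.toNNReal := by exact_mod_cast hn h1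
    linarith
  have hR : signRiemannSum n t m = ∑ k ∈ Finset.range (m + 1),
      (t / (m + 1) : ℝ) * (-1 : ℝ) ^ n (g (k + 1)) := by
    simp [signRiemannSum, g]
  rw [hsum, hR, ← Finset.sum_sub_distrib]
  refine (Finset.abs_sum_le_sum_abs _ _).trans ((Finset.sum_le_sum fun k _ => hterm k).trans ?_)
  rw [← Finset.sum_mul, ← Finset.mul_sum, Finset.sum_range_sub (fun k => (n (g k) : ℝ)), hgm,
    mul_div_assoc]
  gcongr
  linarith [(Nat.cast_nonneg (n (g 0)) : (0 : ℝ) ≤ _)]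

lemma tendsto_signRiemannSum (hn : Monotone n) (t : ℝ≥0) :
    Tendsto (signRiemannSum n t) atTop (𝓝 (signIntegral n t)) := by
  rw [tendsto_iff_norm_sub_tendsto_zero]
  refine squeeze_zero (fun _ => norm_nonneg _) (fun m => ?_)
    (g := fun m : ℕ => 2 * n t * t * (1 / ((m : ℝ) + 1))) ?_
  · rw [norm_sub_rev, mul_one_div]
    exact abs_signIntegral_sub_riemannSum_le hn t m
  · simpa using tendsto_one_div_add_atTop_nhds_zero_nat.const_mul (2 * (n t : ℝ) * t)

/-- Since `ℕ` is discrete, right continuity means being constant on a short interval to the right.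
-/
lemma eventually_path_eq_right (hn : ∀ t, ContinuousWithinAt n (Set.Ici t) t) (x : ℝ) :
    ∀ᶠ y in 𝓝[Set.Ici x] x, n y.toNNReal = n x.toNNReal := by
  have h1 : Tendsto Real.toNNReal (𝓝[Set.Ici x] x) (𝓝[Set.Ici x.toNNReal] x.toNNReal) :=
    tendsto_nhdsWithin_of_tendsto_nhds_of_eventually_within _
      (continuous_real_toNNReal.continuousWithinAt)
      (eventually_nhdsWithin_of_forall fun y hy => Real.toNNReal_mono hy)
  have h2 := (hn x.toNNReal).tendsto.comp h1
  rw [nhds_discrete, tendsto_pure] at h2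
  exact h2

lemma hasDerivWithinAt_signIntegral (hm : Monotone n)
    (hn : ∀ t, ContinuousWithinAt n (Set.Ici t) t) (x : ℝ) :
    HasDerivWithinAt (signIntegral n) ((-1) ^ n x.toNNReal) (Set.Ici x) x := by
  refine intervalIntegral.integral_hasDerivWithinAt_right (intervalIntegrable_sign_path hm _ _)
    (s := Set.Ici x) (t := Set.Ioi x)
    ((measurable_sign_path hm).stronglyMeasurable.stronglyMeasurableAtFilter) ?_
  refine (ContinuousWithinAt.mono ?_ Set.Ioi_subset_Ici_self)
  refine (continuousWithinAt_const (b := (-1 : ℝ) ^ n x.toNNReal)).congr_of_eventuallyEq ?_ rfl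
  filter_upwards [eventually_path_eq_right hn x] with y hy
  rw [hy]

end Paths

/-! ### Differentiating expectations, and the mean sign of a Poisson variable. -/

section Expectations

variable {Ω : Type*} [MeasurableSpace Ω] {P : Measure Ω}

/-- Right derivatives of expectations of functions that are Lipschitz from the right. -/
lemma hasDerivWithinAt_integral_of_lipschitz_right [IsFiniteMeasure P] {F : ℝ → Ω → ℝ}
    {F' : Ω → ℝ} {x K : ℝ} (hF : ∀ y, x ≤ y → Integrable (F y) P)
    (hlip : ∀ᵐ ω ∂P, ∀ y, x ≤ y → |F y ω - F x ω| ≤ K * (y - x))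
    (hd : ∀ᵐ ω ∂P, HasDerivWithinAt (fun y => F y ω) (F' ω) (Set.Ici x) x) :
    HasDerivWithinAt (fun y => ∫ ω, F y ω ∂P) (∫ ω, F' ω ∂P) (Set.Ici x) x := by
  rw [hasDerivWithinAt_iff_tendsto_slope, Set.Ici_sdiff_left]
  have heq : ∀ᶠ y in 𝓝[>] x, ∫ ω, slope (fun y => F y ω) x y ∂P =
      slope (fun y => ∫ ω, F y ω ∂P) x y := by
    filter_upwards [self_mem_nhdsWithin] with y hy
    simp only [slope_def_field]
    rw [integral_div, integral_sub (hF y hy.le) (hF x le_rfl)]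
  refine Tendsto.congr' heq ?_
  refine tendsto_integral_filter_of_dominated_convergence (fun _ => K) ?_ ?_
    (integrable_const _) ?_
  · filter_upwards [self_mem_nhdsWithin] with y hy
    simp only [slope_def_field]
    exact (((hF y hy.le).sub (hF x le_rfl)).div_const _).aestronglyMeasurable
  · filter_upwards [self_mem_nhdsWithin] with y hy
    filter_upwards [hlip] with ω hω
    have hy' : 0 < y - x := sub_pos.2 hy
    rw [slope_def_field, norm_div, Real.norm_eq_abs, Real.norm_eq_abs, abs_of_pos hy',
      div_le_iff₀ hy']
    exact hω y hy.le
  · filter_upwards [hd] with ω hω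
    rw [hasDerivWithinAt_iff_tendsto_slope, Set.Ici_sdiff_left] at hω
    exact hω

/-- The Poisson generating function `exp (r (z - 1))` at `z = -1`; this is the source of the damping
rate `2a`. -/
lemma integral_neg_one_pow_poissonMeasure (r : ℝ≥0) :
    ∫ k, (-1 : ℝ) ^ k ∂(poissonMeasure r) = Real.exp (-(2 * r)) := by
  rw [integral_poissonMeasure]
  have h : ∀ k : ℕ, (Real.exp (-r) * (r : ℝ) ^ k / (k.factorial : ℝ)) • (-1 : ℝ) ^ k =
      Real.exp (-r) * ((-(r : ℝ)) ^ k / k.factorial) := fun k => by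
    rw [smul_eq_mul, neg_pow (r : ℝ)]
    ring
  simp_rw [h]
  rw [tsum_mul_left]
  have := congrFun (NormedSpace.exp_eq_tsum_div (𝔸 := ℝ)) (-(r : ℝ))
  rw [← this, ← Real.exp_eq_exp_ℝ, ← Real.exp_add]
  ring_nf

end Expectations

/-! ### Kac's telegraph equation for the Poisson process. -/

namespace IsPoissonProcess

variable {Ω : Type*} [MeasurableSpace Ω] {P : Measure Ω} {a : ℝ}
  {N : ℝ≥0 → Ω → ℕ}

/-- Measurability is carried by the law of the increment from time `0`, which agrees with `N t`
almost surely. -/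
lemma aemeasurable (h : IsPoissonProcess a N P) (t : ℝ≥0) : AEMeasurable (N t) P := by
  refine (h.law 0 t zero_le).aemeasurable.congr ?_
  filter_upwards [h.zero] with ω hω
  simp [hω]

lemma aemeasurable_sign (h : IsPoissonProcess a N P) (t : ℝ≥0) :
    AEMeasurable (fun ω => (-1 : ℝ) ^ N t ω) P :=
  (measurable_of_countable fun k : ℕ => (-1 : ℝ) ^ k).comp_aemeasurable (h.aemeasurable t)

lemma aemeasurable_riemannSum (h : IsPoissonProcess a N P) (t : ℝ≥0) (m : ℕ) :
    AEMeasurable (fun ω => signRiemannSum (fun s => N s ω) t m) P :=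
  Finset.aemeasurable_fun_sum _ fun _ _ => (h.aemeasurable_sign _).const_mul _

lemma ae_tendsto_riemannSum (h : IsPoissonProcess a N P) (t : ℝ≥0) :
    ∀ᵐ ω ∂P, Tendsto (fun m => signRiemannSum (fun s => N s ω) t m) atTop
      (𝓝 (signIntegral (fun s => N s ω) t)) := by
  filter_upwards [h.mono] with ω hω
  exact tendsto_signRiemannSum hω t

lemma aemeasurable_signIntegral (h : IsPoissonProcess a N P) (t : ℝ≥0) :
    AEMeasurable (fun ω => signIntegral (fun s => N s ω) t) P :=
  aemeasurable_of_tendsto_metrizable_ae' (fun m => h.aemeasurable_riemannSum t m)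
    (h.ae_tendsto_riemannSum t)

lemma integral_sign_increment (h : IsPoissonProcess a N P) (ha : 0 < a) {u t : ℝ≥0} (hut : u ≤ t) :
    ∫ ω, (-1 : ℝ) ^ (N t ω - N u ω) ∂P = Real.exp (-(2 * a * (t - u))) := by
  have h1 := (h.law u t hut).integral_comp (f := fun k : ℕ => (-1 : ℝ) ^ k)
    (measurable_of_countable _).aestronglyMeasurable
  simp only [Function.comp_def] at h1
  have hut' : (u : ℝ) ≤ t := hut
  rw [h1, integral_neg_one_pow_poissonMeasure, Real.coe_toNNReal _
    (mul_nonneg ha.le (sub_nonneg.2 hut'))]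
  ring_nf

/-- The past, through a Riemann sum, is independent of the increment. -/
lemma integral_riemannSum_mul_sign_increment [IsProbabilityMeasure P]
    (h : IsPoissonProcess a N P) (ha : 0 < a)
    {u t : ℝ≥0} (hut : u ≤ t) {g : ℝ → ℝ} (hg : Measurable g) (m : ℕ) :
    ∫ ω, (-1 : ℝ) ^ N t ω * g (signRiemannSum (fun s => N s ω) u m) ∂P =
      Real.exp (-(2 * a * (t - u))) *
        ∫ ω, (-1 : ℝ) ^ N u ω * g (signRiemannSum (fun s => N s ω) u m) ∂P := by
  -- The grid runs through the Riemann nodes up to `u` at index `m + 1` and then stays at `t`.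
  -- Increments `0, …, m` thus determine the past, while increment `m + 1` is `N t - N u`.
  let τ : ℕ → ℝ≥0 := fun k => if k ≤ m + 1 then u * k / (m + 1) else t
  have hτle : ∀ k ≤ m + 1, τ k ≤ u := fun k hk => by
    simp only [τ, if_pos hk]
    rw [div_le_iff₀ (by positivity)]
    gcongr
    exact_mod_cast hk
  have hτ : Monotone τ := by
    intro i j hij
    by_cases hj : j ≤ m + 1
    · simp only [τ, if_pos hj, if_pos (hij.trans hj)]
      gcongr
    · by_cases hi : i ≤ m + 1
      · simpa only [τ, if_neg hj] using (hτle i hi).trans hut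
      · simp only [τ, if_neg hj, if_neg hi, le_refl]
  have hτ0 : τ 0 = 0 := by simp [τ]
  have hτm : τ (m + 1) = u := by
    simp only [τ, le_refl, if_true]
    push_cast
    field_simp
  have hτm' : τ (m + 1 + 1) = t := by simp [τ]
  let X : ℕ → Ω → ℕ := fun i ω => N (τ (i + 1)) ω - N (τ i) ω
  have hX : ∀ i, AEMeasurable (X i) P := fun i => (h.law _ _ (hτ i.le_succ)).aemeasurable
  have hind := (h.indep.nat hτ).indepFun_finset₀ (Finset.range (m + 1)) {m + 1} (by simp) hX
  let ext : (Finset.range (m + 1) → ℕ) → ℕ → ℕ := fun x j =>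
    if hj : j ∈ Finset.range (m + 1) then x ⟨j, hj⟩ else 0
  -- Partial sums of the increments recover `N` at every node, hence both the sign at `u` and the
  -- Riemann sum. Measurability is free, as the domain is countable.
  let φ : (Finset.range (m + 1) → ℕ) → ℝ := fun x =>
    (-1 : ℝ) ^ (∑ j ∈ Finset.range (m + 1), ext x j) *
      g (∑ k ∈ Finset.range (m + 1), (u / (m + 1) : ℝ) *
        (-1 : ℝ) ^ (∑ j ∈ Finset.range (k + 1), ext x j))
  let ψ : (({m + 1} : Finset ℕ) → ℕ) → ℝ := fun x => (-1 : ℝ) ^ x ⟨m + 1, by simp⟩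
  have hind2 := hind.comp (φ := φ) (ψ := ψ) (measurable_of_countable _) (measurable_of_countable _)
  have hφ : ∀ᵐ ω ∂P, φ (fun i => X i ω) =
      (-1 : ℝ) ^ N u ω * g (signRiemannSum (fun s => N s ω) u m) := by
    filter_upwards [h.zero, h.mono] with ω h0 hm
    have hs : ∀ k ≤ m, ∑ j ∈ Finset.range (k + 1), ext (fun i => X i ω) j = N (τ (k + 1)) ω := by
      intro k hk
      have : ∀ j ∈ Finset.range (k + 1), ext (fun i => X i ω) j =
          N (τ (j + 1)) ω - N (τ j) ω := fun j hj => by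
        have : j ∈ Finset.range (m + 1) := by
          simp only [Finset.mem_range] at hj ⊢
          omega
        simp only [ext, dif_pos this, X]
      rw [Finset.sum_congr rfl this, Finset.sum_range_tsub (f := fun j => N (τ j) ω) (hm.comp hτ),
        hτ0, h0, Nat.sub_zero]
    simp only [φ]
    rw [hs m le_rfl, hτm]
    congr 2
    refine Finset.sum_congr rfl fun k hk => ?_
    have hk' : k ≤ m := Nat.lt_succ_iff.1 (Finset.mem_range.1 hk)
    rw [hs k hk']
    simp only [τ, if_pos (Nat.succ_le_succ hk')]
    push_cast
    rfl
  have hψ : ∀ ω, ψ (fun i => X i ω) = (-1 : ℝ) ^ (N t ω - N u ω) := fun ω => by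
    simp only [ψ, X, hτm, hτm']
  have hgm : AEMeasurable (fun ω => (-1 : ℝ) ^ N u ω * g (signRiemannSum (fun s => N s ω) u m)) P :=
    (h.aemeasurable_sign u).mul (hg.comp_aemeasurable (h.aemeasurable_riemannSum u m))
  have hinc : AEMeasurable (fun ω => (-1 : ℝ) ^ (N t ω - N u ω)) P :=
    (measurable_of_countable fun k : ℕ => (-1 : ℝ) ^ k).comp_aemeasurable
      (h.law u t hut).aemeasurable
  have hind3 := (hind2.congr hφ (.of_forall hψ)).integral_fun_mul_eq_mul_integral
    hgm.aestronglyMeasurable hinc.aestronglyMeasurable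
  rw [h.integral_sign_increment ha hut] at hind3
  rw [mul_comm, ← hind3]
  refine integral_congr_ae ?_
  filter_upwards [h.mono] with ω hm
  have : (-1 : ℝ) ^ N t ω = (-1 : ℝ) ^ N u ω * (-1 : ℝ) ^ (N t ω - N u ω) := by
    rw [← pow_add, Nat.add_sub_cancel' (hm hut)]
  rw [this]
  ring

/-- Independence is available only for finitely many increments, so it is used for the Riemann sums
and passed to the limit by dominated convergence; this is where continuity and boundedness of `g`
enter. -/
lemma integral_sign_mul_comp_signIntegral [IsProbabilityMeasure P]
    (h : IsPoissonProcess a N P) (ha : 0 < a)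
    {u t : ℝ≥0} (hut : u ≤ t) {g : ℝ → ℝ} (hg : Continuous g) {K : ℝ} (hK : ∀ x, |g x| ≤ K) :
    ∫ ω, (-1 : ℝ) ^ N t ω * g (signIntegral (fun s => N s ω) u) ∂P =
      Real.exp (-(2 * a * (t - u))) *
        ∫ ω, (-1 : ℝ) ^ N u ω * g (signIntegral (fun s => N s ω) u) ∂P := by
  have hlim : ∀ r : ℝ≥0, Tendsto
      (fun m => ∫ ω, (-1 : ℝ) ^ N r ω * g (signRiemannSum (fun s => N s ω) u m) ∂P) atTop
      (𝓝 (∫ ω, (-1 : ℝ) ^ N r ω * g (signIntegral (fun s => N s ω) u) ∂P)) := fun r => by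
    refine tendsto_integral_of_dominated_convergence (fun _ => K)
      (fun m => ((h.aemeasurable_sign r).mul (hg.measurable.comp_aemeasurable
        (h.aemeasurable_riemannSum u m))).aestronglyMeasurable) (integrable_const _)
      (fun m => .of_forall fun ω => ?_) ?_
    · rw [norm_mul, Real.norm_eq_abs, abs_neg_one_pow_real, one_mul]
      exact hK _
    · filter_upwards [h.ae_tendsto_riemannSum u] with ω hω
      exact ((hg.tendsto _).comp hω).const_mul _
  refine tendsto_nhds_unique (hlim t) ?_
  simp_rw [h.integral_riemannSum_mul_sign_increment ha hut hg.measurable]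
  exact (hlim u).const_mul _

/-- Kac's theorem at a fixed frequency: the cosine transform of the random time solves the
telegraph equation. -/
lemma isTelegraphSystem [IsProbabilityMeasure P]
    (h : IsPoissonProcess a N P) (ha : 0 < a) (l t : ℝ) :
    IsTelegraphSystem a l t
      (fun x => ∫ ω, Real.cos (l * signIntegral (fun s => N s ω) x) ∂P)
      (fun x => ∫ ω, (-1 : ℝ) ^ N x.toNNReal ω *
        Real.sin (l * signIntegral (fun s => N s ω) x) ∂P) := by
  have hmeas : ∀ x : ℝ, 0 ≤ x → AEMeasurable (fun ω => signIntegral (fun s => N s ω) x) P :=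
    fun x hx => by
      have := h.aemeasurable_signIntegral ⟨x, hx⟩
      exact this
  have hle : ∀ (f : Ω → ℝ) (C : ℝ), (∀ᵐ ω ∂P, |f ω| ≤ C) → |∫ ω, f ω ∂P| ≤ C := fun f C hf => by
    simpa using norm_integral_le_of_norm_le_const (f := f) (μ := P) hf
  have hbdd : ∀ f : Ω → ℝ, AEMeasurable f P → (∀ ω, |f ω| ≤ 1) → Integrable f P := fun f hf hb =>
    Integrable.of_bound hf.aestronglyMeasurable 1 (.of_forall hb)
  have hcosI : ∀ x : ℝ, 0 ≤ x →
      Integrable (fun ω => Real.cos (l * signIntegral (fun s => N s ω) x)) P := fun x hx =>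
    hbdd _ (Real.measurable_cos.comp_aemeasurable ((hmeas x hx).const_mul l))
      fun ω => Real.abs_cos_le_one _
  have hsinI : ∀ x y : ℝ, 0 ≤ x → Integrable (fun ω => (-1 : ℝ) ^ N y.toNNReal ω *
      Real.sin (l * signIntegral (fun s => N s ω) x)) P := fun x y hx =>
    hbdd _ ((h.aemeasurable_sign _).mul
      (Real.measurable_sin.comp_aemeasurable ((hmeas x hx).const_mul l)))
      fun ω => by
        rw [abs_mul, abs_neg_one_pow_real, one_mul]
        exact Real.abs_sin_le_one _
  have hcoslip : ∀ᵐ ω ∂P, ∀ x y : ℝ, |Real.cos (l * signIntegral (fun s => N s ω) y) -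
      Real.cos (l * signIntegral (fun s => N s ω) x)| ≤ |l| * |y - x| := by
    filter_upwards [h.mono] with ω hm x y
    refine (Real.abs_cos_sub_cos_le _ _).trans ?_
    rw [← mul_sub, abs_mul]
    exact mul_le_mul_of_nonneg_left (abs_signIntegral_sub_le hm x y) (abs_nonneg l)
  have hsinlip : ∀ᵐ ω ∂P, ∀ x y : ℝ, |Real.sin (l * signIntegral (fun s => N s ω) y) -
      Real.sin (l * signIntegral (fun s => N s ω) x)| ≤ |l| * |y - x| := by
    filter_upwards [h.mono] with ω hm x y
    refine (Real.abs_sin_sub_sin_le _ _).trans ?_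
    rw [← mul_sub, abs_mul]
    exact mul_le_mul_of_nonneg_left (abs_signIntegral_sub_le hm x y) (abs_nonneg l)
  -- The sign jumps, so `q` cannot be differentiated path by path. Freezing the sine at time `x`
  -- leaves a term that is exactly `exp (-(2a (y - x))) q(x)`, plus a remainder whose integrand is
  -- Lipschitz from the right at `x`.
  have hq : ∀ x y : ℝ, 0 ≤ x → x ≤ y → ∫ ω, (-1 : ℝ) ^ N y.toNNReal ω *
        Real.sin (l * signIntegral (fun s => N s ω) y) ∂P =
      (∫ ω, (-1 : ℝ) ^ N y.toNNReal ω * (Real.sin (l * signIntegral (fun s => N s ω) y) -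
        Real.sin (l * signIntegral (fun s => N s ω) x)) ∂P) +
      Real.exp (-(2 * a * (y - x))) * ∫ ω, (-1 : ℝ) ^ N x.toNNReal ω *
        Real.sin (l * signIntegral (fun s => N s ω) x) ∂P := fun x y hx hxy => by
    have h1 := h.integral_sign_mul_comp_signIntegral ha (u := x.toNNReal) (t := y.toNNReal)
      (Real.toNNReal_mono hxy) (g := fun z => Real.sin (l * z)) (by fun_prop) (K := 1)
      (fun z => Real.abs_sin_le_one _)
    rw [Real.coe_toNNReal x hx, Real.coe_toNNReal y (hx.trans hxy)] at h1
    rw [← h1]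
    simp_rw [mul_sub]
    rw [integral_sub (hsinI y y (hx.trans hxy)) (hsinI x y hx)]
    ring
  refine ⟨?_, ?_, ?_, ?_, ?_, ?_⟩
  · refine (LipschitzOnWith.of_dist_le_mul (K := ⟨|l|, abs_nonneg l⟩) fun x hx y hy => ?_).continuousOn
    rw [Real.dist_eq, Real.dist_eq, ← integral_sub (hcosI x hx.1) (hcosI y hy.1)]
    refine hle _ _ ?_
    filter_upwards [hcoslip] with ω hω
    exact hω y x
  · have hq1 : ∀ x y : ℝ, 0 ≤ x → x ≤ y → |(∫ ω, (-1 : ℝ) ^ N y.toNNReal ω *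
        Real.sin (l * signIntegral (fun s => N s ω) y) ∂P) -
        ∫ ω, (-1 : ℝ) ^ N x.toNNReal ω *
        Real.sin (l * signIntegral (fun s => N s ω) x) ∂P| ≤ (|l| + 2 * a) * |y - x| := by
      intro x y hx hxy
      rw [hq x y hx hxy, add_sub_assoc, ← sub_one_mul, add_mul]
      refine (abs_add_le _ _).trans (add_le_add ?_ ?_)
      · refine hle _ _ ?_
        filter_upwards [hsinlip] with ω hω
        rw [abs_mul, abs_neg_one_pow_real, one_mul]
        exact hω x y
      · rw [abs_mul]
        have hyx : 0 ≤ y - x := sub_nonneg.2 hxy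
        have e1 : |Real.exp (-(2 * a * (y - x))) - 1| ≤ 2 * a * |y - x| := by
          rw [abs_sub_comm, abs_of_nonneg (sub_nonneg.2 (Real.exp_le_one_iff.2 (by
            have := mul_nonneg ha.le hyx
            linarith))), abs_of_nonneg hyx]
          linarith [Real.add_one_le_exp (-(2 * a * (y - x)))]
        have e2 : |∫ ω, (-1 : ℝ) ^ N x.toNNReal ω *
            Real.sin (l * signIntegral (fun s => N s ω) x) ∂P| ≤ 1 := by
          refine hle _ _ (.of_forall fun ω => ?_)
          rw [abs_mul, abs_neg_one_pow_real, one_mul]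
          exact Real.abs_sin_le_one _
        exact (mul_le_mul e1 e2 (abs_nonneg _) (by positivity)).trans_eq (mul_one _)
    refine (LipschitzOnWith.of_dist_le_mul (K := ⟨|l| + 2 * a, by positivity⟩)
      fun x hx y hy => ?_).continuousOn
    rw [Real.dist_eq, Real.dist_eq]
    rcases le_total x y with hxy | hxy
    · rw [abs_sub_comm, abs_sub_comm x]
      exact hq1 x y hx.1 hxy
    · exact hq1 y x hy.1 hxy
  · intro x hx
    rw [← integral_const_mul, ← integral_neg]
    refine hasDerivWithinAt_integral_of_lipschitz_right (K := |l|)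
      (fun y hy => hcosI y (hx.1.trans hy)) ?_ ?_
    · filter_upwards [hcoslip] with ω hω y hy
      simpa only [abs_of_nonneg (sub_nonneg.2 hy)] using hω x y
    · filter_upwards [h.mono, h.rightCont] with ω hm hr
      convert! ((hasDerivWithinAt_signIntegral hm hr x).const_mul l).cos using 1
      ring
  · intro x hx
    -- The sine difference vanishes at `y = x`, so the jumping factor does not destroy the Lipschitz
    -- bound. The sign occurs twice in the path derivative, once as the factor and once from `τ'`,
    -- and squares to `1`.
    have h1 : HasDerivWithinAt (fun y => ∫ ω, (-1 : ℝ) ^ N y.toNNReal ω *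
        (Real.sin (l * signIntegral (fun s => N s ω) y) -
        Real.sin (l * signIntegral (fun s => N s ω) x)) ∂P)
        (∫ ω, l * Real.cos (l * signIntegral (fun s => N s ω) x) ∂P) (Set.Ici x) x := by
      refine hasDerivWithinAt_integral_of_lipschitz_right (K := |l|) ?_ ?_ ?_
      · intro y hy
        simp_rw [mul_sub]
        exact (hsinI y y (hx.1.trans hy)).sub (hsinI x y hx.1)
      · filter_upwards [hsinlip] with ω hω y hy
        rw [sub_self, mul_zero, sub_zero, abs_mul, abs_neg_one_pow_real, one_mul]
        simpa only [abs_of_nonneg (sub_nonneg.2 hy)] using hω x y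
      · filter_upwards [h.mono, h.rightCont] with ω hm hr
        have hs := (((hasDerivWithinAt_signIntegral hm hr x).const_mul l).sin.sub_const
          (Real.sin (l * signIntegral (fun s => N s ω) x))).const_mul ((-1 : ℝ) ^ N x.toNNReal ω)
        have hsq : (-1 : ℝ) ^ N x.toNNReal ω * (-1 : ℝ) ^ N x.toNNReal ω = 1 := by
          rw [← mul_pow]; simp
        refine (hs.congr_of_eventuallyEq ?_ rfl).congr_deriv ?_
        · filter_upwards [eventually_path_eq_right hr x] with y hy
          rw [hy]
        · linear_combination l * Real.cos (l * signIntegral (fun s => N s ω) x) * hsq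
    have h2 : HasDerivWithinAt (fun y => Real.exp (-(2 * a * (y - x)))) (-(2 * a)) (Set.Ici x) x := by
      have := ((((hasDerivAt_id x).sub_const x).const_mul (2 * a)).neg.exp).hasDerivWithinAt
        (s := Set.Ici x)
      simpa using this
    have h3 := h1.add (h2.mul_const (∫ ω, (-1 : ℝ) ^ N x.toNNReal ω *
        Real.sin (l * signIntegral (fun s => N s ω) x) ∂P))
    rw [integral_const_mul] at h3
    refine (h3.congr (fun y hy => hq x y hx.1 hy) (hq x x hx.1 le_rfl)).congr_deriv ?_
    ring
  · simp [signIntegral]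
  · simp [signIntegral]

end IsPoissonProcess

/-! ### Random insertions, and the comparison of the two multipliers. -/

section Insertion

open FourierTransform

variable {d : ℕ} {Ω : Type*} [MeasurableSpace Ω] {P : Measure Ω} [IsProbabilityMeasure P]

lemma integral_cos_gaussianReal (z : ℝ) (v : ℝ≥0) :
    ∫ s, Real.cos (z * s) ∂(gaussianReal 0 v) = Real.exp (-(v * z ^ 2 / 2)) := by
  have h := congrArg Complex.re (charFun_gaussianReal (μ := 0) (v := v) z)
  have hint : Integrable (fun s : ℝ => Complex.exp (z * s * Complex.I)) (gaussianReal 0 v) :=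
    Integrable.of_bound (by fun_prop) 1 (.of_forall fun s => by
      rw [← Complex.ofReal_mul, Complex.norm_exp_ofReal_mul_I])
  rw [charFun_apply_real] at h
  have h2 := integral_re hint
  simp only [RCLike.re_to_complex] at h2
  rw [← h2] at h
  simp only [← Complex.ofReal_mul, Complex.exp_ofReal_mul_I_re] at h
  rw [h]
  have : ((z * (0 : ℝ) : ℝ) : ℂ) * Complex.I - (v : ℂ) * (z : ℂ) ^ 2 / 2 =
      ((-(v * z ^ 2 / 2) : ℝ) : ℂ) := by
    push_cast
    ring
  rw [this, Complex.exp_ofReal_re]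

/-- Inserting a random time into a solution of the wave equation. -/
lemma IsWaveSolution.insertion (hd : 1 ≤ d) {c : ℝ} (hc : c ≠ 0)
    {f₀ : EuclideanSpace ℝ (Fin d) → ℂ} {w : ℝ → EuclideanSpace ℝ (Fin d) → ℂ}
    (hw : IsWaveSolution c f₀ w) (hf : MemLp f₀ 2 volume) {X : Ω → ℝ} (hX : AEMeasurable X P) :
    (∀ᵐ x, Integrable (fun ω => w (X ω) x) P) ∧
    ∃ v : Lp ℂ 2 (volume : Measure (EuclideanSpace ℝ (Fin d))),
      v =ᵐ[volume] (fun x => ∫ ω, w (X ω) x ∂P) ∧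
      (𝓕 v : Lp ℂ 2 (volume : Measure (EuclideanSpace ℝ (Fin d)))) =ᵐ[volume]
        fun ξ => ((∫ ω, Real.cos (c * (2 * Real.pi * ‖ξ‖) * X ω) ∂P : ℝ) : ℂ) *
          (𝓕 (hf.toLp f₀) : Lp ℂ 2 (volume : Measure (EuclideanSpace ℝ (Fin d)))) ξ := by
  obtain ⟨W, V, A, hWw, hW, hV, hV0, hA⟩ := hw.wave
  have hW0 : W 0 = hf.toLp f₀ :=
    Lp.ext (((hWw 0).trans hw.initial).trans hf.coeFn_toLp.symm)
  have : IsProbabilityMeasure (P.map X) := Measure.isProbabilityMeasure_map hX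
  obtain ⟨hint, v, hv, hFv⟩ := wave_average hw.measurable hWw
    (fourier_wave_ae_eq hd hc hW hV hV0 hA) (P.map X)
  have hsec : ∀ x, Measurable fun s => w s x := fun x => hw.measurable.comp measurable_prodMk_right
  refine ⟨?_, v, ?_, ?_⟩
  · filter_upwards [hint] with x hx
    exact (integrable_map_measure (hsec x).aestronglyMeasurable hX).1 hx
  · filter_upwards [hv] with x hx
    rw [hx, integral_map hX (hsec x).aestronglyMeasurable]
  · filter_upwards [hFv] with ξ hξ
    rw [hξ, hW0, integral_map hX (by fun_prop)]

/-- Two random insertions differ by the difference of their cosine transforms. -/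
lemma eLpNorm_sub_le_of_fourier {f₀ h u : EuclideanSpace ℝ (Fin d) → ℂ} (hf : MemLp f₀ 2 volume)
    {m₁ m₂ : EuclideanSpace ℝ (Fin d) → ℝ} {K : ℝ} (hK : ∀ ξ, |m₁ ξ - m₂ ξ| ≤ K)
    {v₁ v₂ : Lp ℂ 2 (volume : Measure (EuclideanSpace ℝ (Fin d)))}
    (h₁ : v₁ =ᵐ[volume] h) (h₂ : v₂ =ᵐ[volume] u)
    (hF₁ : (𝓕 v₁ : Lp ℂ 2 (volume : Measure (EuclideanSpace ℝ (Fin d)))) =ᵐ[volume]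
      fun ξ => (m₁ ξ : ℂ) *
        (𝓕 (hf.toLp f₀) : Lp ℂ 2 (volume : Measure (EuclideanSpace ℝ (Fin d)))) ξ)
    (hF₂ : (𝓕 v₂ : Lp ℂ 2 (volume : Measure (EuclideanSpace ℝ (Fin d)))) =ᵐ[volume]
      fun ξ => (m₂ ξ : ℂ) *
        (𝓕 (hf.toLp f₀) : Lp ℂ 2 (volume : Measure (EuclideanSpace ℝ (Fin d)))) ξ) :
    eLpNorm (h - u) 2 volume ≤ ENNReal.ofReal K * eLpNorm f₀ 2 volume := by
  have hK0 : 0 ≤ K := (abs_nonneg _).trans (hK 0)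
  have hsub : (𝓕 (v₁ - v₂) : Lp ℂ 2 (volume : Measure (EuclideanSpace ℝ (Fin d)))) =
      𝓕 v₁ - 𝓕 v₂ := (Lp.fourierTransformₗᵢ (EuclideanSpace ℝ (Fin d)) ℂ).map_sub v₁ v₂
  have hnorm : ‖v₁ - v₂‖ ≤ K * ‖hf.toLp f₀‖ := by
    rw [← Lp.norm_fourier_eq (v₁ - v₂), ← Lp.norm_fourier_eq (hf.toLp f₀), hsub]
    refine Lp.norm_le_mul_norm_of_ae_le_mul ?_
    filter_upwards [Lp.coeFn_sub (𝓕 v₁ : Lp ℂ 2 (volume : Measure (EuclideanSpace ℝ (Fin d))))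
      (𝓕 v₂), hF₁, hF₂] with ξ e1 e2 e3
    rw [e1, Pi.sub_apply, e2, e3, ← sub_mul, norm_mul, ← Complex.ofReal_sub, Complex.norm_real]
    gcongr
    exact hK ξ
  have heq : (v₁ - v₂ : Lp ℂ 2 (volume : Measure (EuclideanSpace ℝ (Fin d)))) =ᵐ[volume] h - u := by
    filter_upwards [Lp.coeFn_sub v₁ v₂, h₁, h₂] with x e1 e2 e3
    rw [e1, Pi.sub_apply, Pi.sub_apply, e2, e3]
  rw [← eLpNorm_congr_ae heq, ← eLpNorm_congr_ae hf.coeFn_toLp, ← Lp.enorm_def, ← Lp.enorm_def,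
    ← ofReal_norm, ← ofReal_norm, ← ENNReal.ofReal_mul hK0]
  exact ENNReal.ofReal_le_ofReal hnorm

variable {Ω' : Type*} [MeasurableSpace Ω'] {P' : Measure Ω'} [IsProbabilityMeasure P']
  {a c σ : ℝ} {f₀ : EuclideanSpace ℝ (Fin d) → ℂ} {w₁ w_c : ℝ → EuclideanSpace ℝ (Fin d) → ℂ}
  {N : ℝ≥0 → Ω → ℕ} {B : ℝ≥0 → Ω' → ℝ}

/-- The relation `σ² = c² / a` makes the Gaussian exponent equal to `l² t / (2a)` at the frequency
`l = 2π c ‖ξ‖` of the Kac multiplier. The telegraph estimate is uniform in `l`, hence in `ξ`. -/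
lemma eLpNorm_wienerInsertion_sub_kacInsertion_le (hd : 1 ≤ d) (hf : MemLp f₀ 2 volume)
    (ha : 0 < a) (hc : 0 < c) (hσ : σ ^ 2 = c ^ 2 / a) (h₁ : IsWaveSolution 1 f₀ w₁)
    (h_c : IsWaveSolution c f₀ w_c) (hN : IsPoissonProcess a N P) (hB : IsBrownianReal B P')
    {t : ℝ≥0} (ht : 0 < t) :
    eLpNorm (wienerInsertion P' B σ w₁ t - kacInsertion P N w_c t) 2 volume ≤
      ENNReal.ofReal (47 / (a * t)) * eLpNorm f₀ 2 volume := by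
  have hBm : AEMeasurable (fun ω => σ * B t ω) P' := (hB.aemeasurable t).const_mul σ
  obtain ⟨-, v₁, hv₁, hF₁⟩ := h₁.insertion hd one_ne_zero hf hBm
  obtain ⟨-, v₂, hv₂, hF₂⟩ := h_c.insertion hd hc.ne' hf (hN.aemeasurable_signIntegral t)
  refine eLpNorm_sub_le_of_fourier hf (fun ξ => ?_) hv₁ hv₂ hF₁ hF₂
  have hw : ∫ ω, Real.cos (1 * (2 * Real.pi * ‖ξ‖) * (σ * B t ω)) ∂P' =
      Real.exp (-((c * (2 * Real.pi * ‖ξ‖)) ^ 2 * t / (2 * a))) := by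
    have hl := (hB.hasLaw_eval t).integral_comp
      (f := fun s => Real.cos (1 * (2 * Real.pi * ‖ξ‖) * σ * s)) (by fun_prop)
    simp only [Function.comp_def] at hl
    simp_rw [← mul_assoc _ σ]
    rw [hl, integral_cos_gaussianReal]
    congr 1
    rw [mul_pow _ σ, hσ]
    field_simp
  rw [hw, abs_sub_comm]
  exact (hN.isTelegraphSystem ha _ t).abs_sub_exp_le ha (by exact_mod_cast ht)

/-- The quantitative bound requires `t > 0`; at `t = 0` both random times vanish almost surely and
each insertion returns `f₀`. -/
lemma wienerInsertion_sub_kacInsertion_zero (h₁ : IsWaveSolution 1 f₀ w₁)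
    (h_c : IsWaveSolution c f₀ w_c) (hB : IsBrownianReal B P') :
    eLpNorm (wienerInsertion P' B σ w₁ 0 - kacInsertion P N w_c 0) 2 volume = 0 := by
  rw [eLpNorm_congr_ae (g := 0), eLpNorm_zero]
  filter_upwards [h₁.initial, h_c.initial] with x hx₁ hx_c
  have e1 : wienerInsertion P' B σ w₁ 0 x = f₀ x := by
    have : (fun ω => w₁ (σ * B 0 ω) x) =ᵐ[P'] fun _ => f₀ x := by
      filter_upwards [hB.eval_zero_ae_eq_zero] with ω hω
      rw [hω, mul_zero, hx₁]
    rw [wienerInsertion, integral_congr_ae this]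
    simp
  have e2 : kacInsertion P N w_c 0 x = f₀ x := by
    simp [kacInsertion, randomTime, hx_c]
  simp [e1, e2]

lemma tendsto_ofReal_div_mul {M : ℝ≥0∞} (hM : M ≠ ∞) (C b : ℝ) (hb : 0 < b) :
    Tendsto (fun x : ℝ => ENNReal.ofReal (C / (b * x)) * M) atTop (𝓝 0) := by
  have h1 : Tendsto (fun x : ℝ => C / (b * x)) atTop (𝓝 0) :=
    (tendsto_id.const_mul_atTop hb).const_div_atTop C
  have h2 := ENNReal.tendsto_ofReal h1
  rw [ENNReal.ofReal_zero] at h2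
  simpa using ENNReal.Tendsto.mul_const h2 (.inr hM)

end Insertion

theorem theorem5p3 (d : ℕ) (hd : 1 ≤ d) :
    -- the bound, with a constant depending on `c₀` and `d` only, and the limit `t → ∞`
    (∀ c₀ : ℝ, 0 < c₀ → ∃ C : ℝ, 0 < C ∧
      ∀ (f₀ : EuclideanSpace ℝ (Fin d) → ℂ), IsSobolevH2 f₀ →
      ∀ a c σ : ℝ, 0 < a → c₀ ≤ c → 0 < σ → σ ^ 2 = c ^ 2 / a →
      ∀ (w₁ w_c : ℝ → EuclideanSpace ℝ (Fin d) → ℂ),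
        IsWaveSolution 1 f₀ w₁ → IsWaveSolution c f₀ w_c →
      ∀ (Ω : Type*) [MeasurableSpace Ω] (P : Measure Ω) [IsProbabilityMeasure P]
        (N : ℝ≥0 → Ω → ℕ), IsPoissonProcess a N P →
      ∀ (Ω' : Type*) [MeasurableSpace Ω'] (P' : Measure Ω') [IsProbabilityMeasure P']
        (B : ℝ≥0 → Ω' → ℝ), IsBrownianReal B P' →
      -- the expectations exist for almost every `x` and define functions in `L²`
      (∀ t : ℝ≥0,
        (∀ᵐ x : EuclideanSpace ℝ (Fin d), Integrable (fun ω => w_c (randomTime N t ω) x) P) ∧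
        (∀ᵐ x : EuclideanSpace ℝ (Fin d), Integrable (fun ω => w₁ (σ * B t ω) x) P') ∧
        MemLp (kacInsertion P N w_c t) 2 volume ∧
        MemLp (wienerInsertion P' B σ w₁ t) 2 volume) ∧
      (∀ t : ℝ≥0, 0 < t →
        eLpNorm (wienerInsertion P' B σ w₁ t - kacInsertion P N w_c t) 2 volume ≤
          ENNReal.ofReal (C * (1 / (a * t) + 1 / (c * (t * a) ^ (1 / 2 : ℝ)))) *
            eLpNorm f₀ 2 volume) ∧
      Tendsto
        (fun t : ℝ≥0 =>
          eLpNorm (wienerInsertion P' B σ w₁ t - kacInsertion P N w_c t) 2 volume)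
        atTop (𝓝 0)) ∧
    -- the limit `a, c → ∞` with `c² / a = σ²` fixed, at every time
    (∀ (f₀ : EuclideanSpace ℝ (Fin d) → ℂ), IsSobolevH2 f₀ →
      ∀ σ : ℝ, 0 < σ → ∀ t : ℝ≥0, ∀ ε : ℝ≥0∞, 0 < ε →
      ∃ A : ℝ, ∀ a c : ℝ, 0 < a → 0 < c → A ≤ a → A ≤ c → c ^ 2 / a = σ ^ 2 →
      ∀ (w₁ w_c : ℝ → EuclideanSpace ℝ (Fin d) → ℂ),
        IsWaveSolution 1 f₀ w₁ → IsWaveSolution c f₀ w_c →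
      ∀ (Ω : Type*) [MeasurableSpace Ω] (P : Measure Ω) [IsProbabilityMeasure P]
        (N : ℝ≥0 → Ω → ℕ), IsPoissonProcess a N P →
      ∀ (Ω' : Type*) [MeasurableSpace Ω'] (P' : Measure Ω') [IsProbabilityMeasure P']
        (B : ℝ≥0 → Ω' → ℝ), IsBrownianReal B P' →
      eLpNorm (wienerInsertion P' B σ w₁ t - kacInsertion P N w_c t) 2 volume ≤ ε) := by
  constructor
  · intro c₀ hc₀
    refine ⟨47, by norm_num, ?_⟩
    intro f₀ hf₀ a c σ ha hc hσ0 hσ w₁ w_c h₁ h_c Ω _ P _ N hN Ω' _ P' _ B hB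
    obtain ⟨hf, -⟩ := hf₀
    have hc0 : 0 < c := hc₀.trans_le hc
    have hmain : ∀ t : ℝ≥0, 0 < t →
        eLpNorm (wienerInsertion P' B σ w₁ t - kacInsertion P N w_c t) 2 volume ≤
          ENNReal.ofReal (47 / (a * t)) * eLpNorm f₀ 2 volume := fun t ht =>
      eLpNorm_wienerInsertion_sub_kacInsertion_le hd hf ha hc0 hσ h₁ h_c hN hB ht
    refine ⟨fun t => ?_, fun t ht => ?_, ?_⟩
    · obtain ⟨hi₁, v₁, hv₁, -⟩ := h₁.insertion hd one_ne_zero hf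
        ((hB.aemeasurable t).const_mul σ)
      obtain ⟨hi₂, v₂, hv₂, -⟩ := h_c.insertion hd hc0.ne' hf (hN.aemeasurable_signIntegral t)
      exact ⟨hi₂, hi₁, (Lp.memLp v₂).ae_eq hv₂, (Lp.memLp v₁).ae_eq hv₁⟩
    -- The summand `1 / (c (t a)^(1/2))` is nonnegative and is added only as slack.
    · refine (hmain t ht).trans ?_
      gcongr
      rw [div_eq_mul_one_div]
      gcongr
      exact le_add_of_nonneg_right (by positivity)
    · refine tendsto_of_tendsto_of_tendsto_of_le_of_le' tendsto_const_nhds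
        ((tendsto_ofReal_div_mul hf.2.ne 47 a ha).comp (NNReal.tendsto_coe_atTop.2 tendsto_id))
        (.of_forall fun _ => zero_le) ?_
      filter_upwards [eventually_gt_atTop 0] with t ht
      exact hmain t ht
  · intro f₀ hf₀ σ hσ0 t ε hε
    obtain ⟨hf, -⟩ := hf₀
    rcases eq_or_ne t 0 with rfl | ht
    · refine ⟨0, fun a c _ _ _ _ _ w₁ w_c h₁ h_c Ω _ P _ N _ Ω' _ P' _ B hB => ?_⟩
      rw [wienerInsertion_sub_kacInsertion_zero h₁ h_c hB]
      exact zero_le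
    · have ht' : 0 < t := pos_iff_ne_zero.2 ht
      -- For fixed `t > 0` the bound is a constant over `t a`, so a large `a` makes it at most `ε`.
      obtain ⟨A, hA⟩ := eventually_atTop.1
        ((tendsto_ofReal_div_mul hf.2.ne 47 t (by exact_mod_cast ht')).eventually_le_const hε)
      refine ⟨A, fun a c ha hc hAa _ hσ w₁ w_c h₁ h_c Ω _ P _ N hN Ω' _ P' _ B hB => ?_⟩
      refine (eLpNorm_wienerInsertion_sub_kacInsertion_le hd hf ha hc hσ.symm h₁ h_c hN hB
        ht').trans ?_
      rw [mul_comm a]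
      exact hA a hAa
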